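/- Let $M$ be a nonempty compact smooth manifold without boundary of dimension $n\ge 2$, let $\rho\in\mathbb R$ with $\rho\le \frac{1}{2(n-1)}$, let $T\in(0,+\infty]$, and let $g(t)$, $t\in[0,T)$, be a smooth family of Riemannian metrics on $M$ (smooth on $[0,T)\times M$) solving the Ricci–Bourguignon flow $$\frac{\partial}{\partial t} g=-2\,\mathrm{Ric}_{g(t)}+2\rho\,\mathrm R_{g(t)}\,g(t),$$ where $\mathrm{Ric}$ is the Ricci tensor and $\mathrm R$ the scalar curvature. Then the following hold; $T$ need not be the maximal existence time, and in particular they hold when $[0,T)$ is the maximal time interval of the solution. 1. For each $t\in[0,T)$ the minimum $\mathrm R_{\min}(t)=\min_{x\in M}\mathrm R_{g(t)}(x)$ exists, and $t\mapsto \mathrm R_{\min}(t)$ is nondecreasing on $[0,T)$. 2. For every $\alpha\in\mathbb R$, if $\mathrm R_{g(0)}\ge\alpha$ on $M$, then $\mathrm R_{g(t)}\ge\alpha$ on $M$ for every $t\in[0,T)$. 3. If moreover $\alpha>0$ and $n\rho<1$, then $T\le \dfrac{n}{2(1-n\rho)\alpha}$; in particular $T<+\infty$. (The condition $n\rho<1$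 follows from $\rho\le\frac1{2(n-1)}$ except when $n=2$ and $\rho=\frac12$; in that case the flow is static and the right-hand side is to be read as $+\infty$.) -/

import Mathlib

open scoped Manifold ContDiff Bundle

noncomputable section

namespace RicciBourguignon

/-! ### Curvature of a matrix-valued metric in Euclidean coordinates -/

/-- The partial derivative `∂f/∂xⁱ` at `y`. -/
def partialDeriv {n : ℕ} (i : Fin n) (f : EuclideanSpace ℝ (Fin n) → ℝ)
    (y : EuclideanSpace ℝ (Fin n)) : ℝ :=
  fderiv ℝ f y (EuclideanSpace.single i 1)

section Coordinates

variable {n : ℕ} (G : EuclideanSpace ℝ (Fin n) → Matrix (Fin n) (Fin n) ℝ)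

/-- Christoffel symbols
`Γᵏᵢⱼ = ½ gᵏˡ (∂ᵢ gⱼₗ + ∂ⱼ gᵢₗ - ∂ₗ gᵢⱼ)` of the metric with components `G`. -/
def christoffel (k i j : Fin n) (y : EuclideanSpace ℝ (Fin n)) : ℝ :=
  (1 / 2) * ∑ l, (G y)⁻¹ k l *
    (partialDeriv i (fun z ↦ G z j l) y + partialDeriv j (fun z ↦ G z i l) y
      - partialDeriv l (fun z ↦ G z i j) y)

/-- The components `Rˡᵢⱼₖ` of the (3,1) Riemann tensor, with the convention
`Riem(X,Y)Z = ∇_Y ∇_X Z - ∇_X ∇_Y Z + ∇_[X,Y] Z` and `Rˡᵢⱼₖ ∂ₗ = Riem(∂ᵢ,∂ⱼ)∂ₖ`, that is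
`Rˡᵢⱼₖ = ∂ⱼ Γˡᵢₖ - ∂ᵢ Γˡⱼₖ + Γᵐᵢₖ Γˡⱼₘ - Γᵐⱼₖ Γˡᵢₘ`. -/
def riemannUp (l i j k : Fin n) (y : EuclideanSpace ℝ (Fin n)) : ℝ :=
  partialDeriv j (christoffel G l i k) y - partialDeriv i (christoffel G l j k) y
    + ∑ m, (christoffel G m i k y * christoffel G l j m y
      - christoffel G m j k y * christoffel G l i m y)

/-- The components `Rᵢⱼₖₗ = gₗₘ Rᵐᵢⱼₖ` of the (4,0) Riemann tensor. -/
def riemannDown (i j k l : Fin n) (y : EuclideanSpace ℝ (Fin n)) : ℝ :=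
  ∑ m, G y l m * riemannUp G m i j k y

/-- The components `Rᵢₖ = gʲˡ Rᵢⱼₖₗ` of the Ricci tensor. -/
def ricciCoord (i k : Fin n) (y : EuclideanSpace ℝ (Fin n)) : ℝ :=
  ∑ j, ∑ l, (G y)⁻¹ j l * riemannDown G i j k l y

/-- The scalar curvature `R = gⁱᵏ Rᵢₖ`. -/
def scalarCoord (y : EuclideanSpace ℝ (Fin n)) : ℝ :=
  ∑ i, ∑ k, (G y)⁻¹ i k * ricciCoord G i k y

end Coordinates

/-! ### Curvature of a Riemannian metric on a manifold -/

/-- Smooth Riemannian metrics on the `n`-dimensional manifold `M`. -/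
abbrev Metric (n : ℕ) (M : Type*) [TopologicalSpace M]
    [ChartedSpace (EuclideanSpace ℝ (Fin n)) M] [IsManifold (𝓡 n) ∞ M] :=
  Bundle.ContMDiffRiemannianMetric (𝓡 n) ∞ (EuclideanSpace ℝ (Fin n))
    (fun x : M ↦ TangentSpace (𝓡 n) x)

section Manifold

variable {n : ℕ} {M : Type*} [TopologicalSpace M]
  [ChartedSpace (EuclideanSpace ℝ (Fin n)) M] [IsManifold (𝓡 n) ∞ M]

/-- The coordinate vector `∂ᵢ` of the preferred chart at `p`, at the point of `M` whose
coordinates are `y`. -/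
def coordVector (p : M) (i : Fin n) (y : EuclideanSpace ℝ (Fin n)) :
    TangentSpace (𝓡 n) ((extChartAt (𝓡 n) p).symm y) :=
  mfderiv 𝓘(ℝ, EuclideanSpace ℝ (Fin n)) (𝓡 n) (extChartAt (𝓡 n) p).symm y
    (EuclideanSpace.single i 1 : EuclideanSpace ℝ (Fin n))

/-- The components `gᵢⱼ = g(∂ᵢ, ∂ⱼ)` of the metric in the preferred chart at `p`, as functions
of the coordinates. -/
def metricCoord (g : Metric n M) (p : M) (y : EuclideanSpace ℝ (Fin n)) :
    Matrix (Fin n) (Fin n) ℝ :=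
  Matrix.of fun i j ↦
    g.inner ((extChartAt (𝓡 n) p).symm y) (coordVector p i y) (coordVector p j y)

/-- The `i`-th component, in the preferred chart at `p`, of a tangent vector at `p`. -/
def component (p : M) (v : TangentSpace (𝓡 n) p) (i : Fin n) : ℝ :=
  let w : EuclideanSpace ℝ (Fin n) :=
    mfderiv (𝓡 n) 𝓘(ℝ, EuclideanSpace ℝ (Fin n)) (extChartAt (𝓡 n) p) p v
  w i

/-- The Ricci tensor `Ric_g(v, w)` at `p`, computed in the preferred chart at `p`. -/
def ricci (g : Metric n M) (p : M) (v w : TangentSpace (𝓡 n) p) : ℝ :=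
  ∑ i, ∑ k, ricciCoord (metricCoord g p) i k (extChartAt (𝓡 n) p p)
    * component p v i * component p w k

/-- The scalar curvature `R_g` at `p`, computed in the preferred chart at `p`. -/
def scalarCurvature (g : Metric n M) (p : M) : ℝ :=
  scalarCoord (metricCoord g p) (extChartAt (𝓡 n) p p)

/-! ### The flow -/

/-- The time interval `[0, T)`, where `T = ∞` is allowed. -/
def timeInterval (T : EReal) : Set ℝ := {t | 0 ≤ t ∧ (t : EReal) < T}

/-- `g(t)`, `t ∈ [0, T)`, is a smooth solution of the Ricci-Bourguignon flow
`∂g/∂t = -2 Ric + 2 ρ R g` on `M` (the derivative at `t = 0` is one-sided). The values `g t` for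
`t ∉ [0, T)` play no role. -/
structure IsRBFlow (ρ : ℝ) (T : EReal) (g : ℝ → Metric n M) : Prop where
  /-- The tensor field `(t, x) ↦ g(t)ₓ` is smooth on `[0, T) × M`. -/
  smooth : ContMDiffOn (𝓘(ℝ, ℝ).prod (𝓡 n))
    ((𝓡 n).prod 𝓘(ℝ, EuclideanSpace ℝ (Fin n) →L[ℝ] EuclideanSpace ℝ (Fin n) →L[ℝ] ℝ)) ∞
    (fun q : ℝ × M ↦ Bundle.TotalSpace.mk'
      (EuclideanSpace ℝ (Fin n) →L[ℝ] EuclideanSpace ℝ (Fin n) →L[ℝ] ℝ)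
      (E := fun x : M ↦ TangentSpace (𝓡 n) x →L[ℝ] TangentSpace (𝓡 n) x →L[ℝ] ℝ)
      q.2 ((g q.1).inner q.2))
    (timeInterval T ×ˢ Set.univ)
  equation : ∀ t ∈ timeInterval T, ∀ (x : M) (v w : TangentSpace (𝓡 n) x),
    HasDerivWithinAt (fun s ↦ (g s).inner x v w)
      (-2 * ricci (g t) x v w + 2 * ρ * scalarCurvature (g t) x * (g t).inner x v w)
      (timeInterval T) t

end Manifold

end RicciBourguignon

end

open RicciBourguignon

/-! The heart of the matter is the evolution equation `∂ₜR = (1 - 2(n-1)ρ) ΔR + 2|Ric|² - 2ρR²`. The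
bound on `ρ` makes the coefficient of `ΔR` nonnegative, and `|Ric|² ≥ R²/n` by Cauchy–Schwarz. At a
spatial minimum of `R`, where `ΔR ≥ 0`, this leaves `∂ₜR ≥ 2(1/n - ρ)R² ≥ 0`, since `ρ ≤ 1/(2(n-1))
≤ 1/n`. The maximum principle on the compact manifold then preserves every lower bound of `R`, from
any starting time, which gives the monotonicity of the minimum. If `R ≥ α > 0` and `nρ < 1`, the
same principle applied to `-1/R - ct` with `c = 2(1/n - ρ)` yields `ct < 1/α`, hence the bound on
`T`.

The evolution equation is proved as an identity in a commutative `ℝ`-algebra with commuting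
derivations `d i` (space) and `δ` (time): `IsLeviCivita.evolution_scalar`. It combines the traced
Palatini formula for `δ Ric`, which involves only two divergences, with the contracted second
Bianchi identity. The Christoffel symbols are handled through their characterization `IsLeviCivita`
(torsion free and metric), so their variation is never computed entry by entry.

The algebra is realized by `SmoothOn S x₀`, the smooth functions on `S`. With `S = I ×ˢ U` it gives
the evolution in a fixed chart, including the one-sided derivative at `t = 0`. With open sets of
coordinates it gives the naturality of curvature under coordinate changes (`curvature_pullback`).
Naturality is indispensable because the curvature at each point is defined in the preferred chart of
that very point, so even continuity of `R` requires comparing charts; `curvature_in_chart` does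
this. -/

noncomputable section

namespace RicciBourguignon

/-! ### Riemannian geometry over a ring with commuting derivations -/

section Algebra

open Matrix

variable {ι : Type*} {A : Type*} [CommRing A] [Algebra ℝ A]

/-- Entrywise application of a derivation to a matrix. -/
def matDeriv (D : Derivation ℝ A A) (X : Matrix ι ι A) : Matrix ι ι A := X.map D

@[simp] lemma matDeriv_apply (D : Derivation ℝ A A) (X : Matrix ι ι A) (i j : ι) :
    matDeriv D X i j = D (X i j) := rfl

lemma matDeriv_add (D : Derivation ℝ A A) (X Y : Matrix ι ι A) :
    matDeriv D (X + Y) = matDeriv D X + matDeriv D Y := by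
  ext; simp

lemma matDeriv_sub (D : Derivation ℝ A A) (X Y : Matrix ι ι A) :
    matDeriv D (X - Y) = matDeriv D X - matDeriv D Y := by
  ext; simp

lemma matDeriv_transpose (D : Derivation ℝ A A) (X : Matrix ι ι A) :
    matDeriv D Xᵀ = (matDeriv D X)ᵀ := rfl

lemma matDeriv_sum {κ : Type*} (s : Finset κ) (D : Derivation ℝ A A) (X : κ → Matrix ι ι A) :
    matDeriv D (∑ k ∈ s, X k) = ∑ k ∈ s, matDeriv D (X k) := by
  ext; simp [Matrix.sum_apply]

lemma matDeriv_smul (D : Derivation ℝ A A) (a : A) (X : Matrix ι ι A) :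
    matDeriv D (a • X) = D a • X + a • matDeriv D X := by
  ext; simp; ring

lemma matDeriv_one [DecidableEq ι] (D : Derivation ℝ A A) :
    matDeriv D (1 : Matrix ι ι A) = 0 := by
  ext i j; by_cases h : i = j <;> simp [h, one_apply]

lemma matDeriv_comm {D E : Derivation ℝ A A} (h : ∀ f, D (E f) = E (D f)) (X : Matrix ι ι A) :
    matDeriv D (matDeriv E X) = matDeriv E (matDeriv D X) := by
  ext; simp [h]

variable [Fintype ι]

lemma matDeriv_mul (D : Derivation ℝ A A) (X Y : Matrix ι ι A) :
    matDeriv D (X * Y) = matDeriv D X * Y + X * matDeriv D Y := by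
  ext i j
  simp only [matDeriv_apply, mul_apply, map_sum, Derivation.leibniz, smul_eq_mul, Matrix.add_apply,
    ← Finset.sum_add_distrib]
  exact Finset.sum_congr rfl fun _ _ ↦ by ring

lemma trace_matDeriv (D : Derivation ℝ A A) (X : Matrix ι ι A) :
    (matDeriv D X).trace = D X.trace := by
  simp [trace]

/-- The curvature `Fᵢⱼ = ∂ᵢ Γⱼ - ∂ⱼ Γᵢ + [Γᵢ, Γⱼ]` of the connection `Γ`, where `Γᵢ` is the matrix
`(Γᵏᵢⱼ)ₖⱼ`. -/
def curvature (d : ι → Derivation ℝ A A) (Γ : ι → Matrix ι ι A) (i j : ι) : Matrix ι ι A :=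
  matDeriv (d i) (Γ j) - matDeriv (d j) (Γ i) + (Γ i * Γ j - Γ j * Γ i)

/-- The Ricci tensor `Ricᵢₖ = (Fⱼᵢ)ʲₖ` of a connection. -/
def ricciOf (d : ι → Derivation ℝ A A) (Γ : ι → Matrix ι ι A) : Matrix ι ι A :=
  of fun i k ↦ ∑ j, curvature d Γ j i j k

/-- The trace `Qⁱᵏ Ricᵢₖ` of the Ricci tensor of a connection. -/
def scalarOf (d : ι → Derivation ℝ A A) (Q : Matrix ι ι A) (Γ : ι → Matrix ι ι A) : A :=
  ∑ i, ∑ k, Q i k * ricciOf d Γ i k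

/-- `Γ` is torsion free and compatible with `g`. -/
structure IsLeviCivita (d : ι → Derivation ℝ A A) (g : Matrix ι ι A) (Γ : ι → Matrix ι ι A) :
    Prop where
  symm : ∀ i j k, Γ i k j = Γ j k i
  compat : ∀ i, matDeriv (d i) g = g * Γ i + (g * Γ i)ᵀ

/-- The Christoffel symbols of `g`, where `Q` is the inverse of `g`. -/
def leviCivita (d : ι → Derivation ℝ A A) (g Q : Matrix ι ι A) (i : ι) : Matrix ι ι A :=
  of fun k j ↦ algebraMap ℝ A (1 / 2) * ∑ l, Q k l * (d i (g j l) + d j (g i l) - d l (g i j))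

lemma algebraMap_half_mul_two : algebraMap ℝ A (1 / 2) * 2 = 1 := by
  rw [← map_ofNat (algebraMap ℝ A) 2, ← map_mul]; simp

variable {d : ι → Derivation ℝ A A} {g Q : Matrix ι ι A} {Γ : ι → Matrix ι ι A}

/-- Koszul's argument: each derivative of `g` is a sum of two lowered Christoffel symbols, and
torsion-freeness cancels all but one in the alternating sum. -/
lemma IsLeviCivita.two_mul_lower (h : IsLeviCivita d g Γ) (i j l : ι) :
    2 * (g * Γ i) l j = d i (g j l) + d j (g i l) - d l (g i j) := by
  have hc : ∀ a b c, (g * Γ a) c b = (g * Γ b) c a := fun a b c ↦ by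
    simp only [mul_apply, h.symm a b]
  have e : ∀ a b c, d a (g b c) = (g * Γ a) b c + (g * Γ a) c b := fun a b c ↦ by
    have := congrFun₂ (h.compat a) b c
    rwa [Matrix.add_apply, transpose_apply] at this
  rw [e, e, e, hc i l j, hc l j i, hc j i l]
  ring

variable [DecidableEq ι]

/-- Uniqueness of the Levi-Civita connection. It later identifies the transformed connection with
the Christoffel symbols of the transformed metric, with no direct computation. -/
lemma IsLeviCivita.eq_leviCivita (h : IsLeviCivita d g Γ) (hQ : Q * g = 1) :
    Γ = leviCivita d g Q := by
  funext i
  have hm : Γ i = Q * (g * Γ i) := by rw [← mul_assoc, hQ, one_mul]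
  ext k j
  rw [hm, leviCivita, of_apply, mul_apply, Finset.mul_sum]
  refine Finset.sum_congr rfl fun l _ ↦ ?_
  linear_combination (algebraMap ℝ A (1 / 2) * Q k l) * h.two_mul_lower i j l -
    Q k l * (g * Γ i) l j * algebraMap_half_mul_two (A := A)

lemma isLeviCivita_leviCivita (hg : gᵀ = g) (hQ : g * Q = 1) :
    IsLeviCivita d g (leviCivita d g Q) := by
  have hs : ∀ i j, g i j = g j i := fun i j ↦ congrFun₂ hg j i
  refine ⟨fun i j k ↦ ?_, fun i ↦ ?_⟩
  · simp only [leviCivita, of_apply, hs j i]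
    congr 1
    exact Finset.sum_congr rfl fun l _ ↦ by ring
  · have hm : leviCivita d g Q i = Q * of fun l j ↦ algebraMap ℝ A (1 / 2) *
        (d i (g j l) + d j (g i l) - d l (g i j)) := by
      ext k j
      simp only [leviCivita, of_apply, mul_apply, Finset.mul_sum]
      exact Finset.sum_congr rfl fun l _ ↦ by ring
    rw [hm, ← mul_assoc, hQ, one_mul]
    ext a b
    simp only [matDeriv_apply, Matrix.add_apply, of_apply, transpose_apply, hs b a]
    linear_combination - d i (g a b) * algebraMap_half_mul_two (A := A)

/-! #### Behaviour under change of coordinates -/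

section Covariance

variable {B : Type*} [CommRing B] [Algebra ℝ B] {d' : ι → Derivation ℝ B B} {ψ : A →ₐ[ℝ] B}
  {J K : Matrix ι ι B}

omit [DecidableEq ι] in
lemma matDeriv_map {a : ι} (hψ : ∀ f, d' a (ψ f) = ∑ i, J i a * ψ (d i f)) (X : Matrix ι ι A) :
    matDeriv (d' a) (X.map ψ) = ∑ i, J i a • (matDeriv (d i) X).map ψ := by
  ext; simp [Matrix.sum_apply, hψ]

/-- The connection `J⁻¹ (φ^* Γ) J + J⁻¹ dJ` in new coordinates. -/
def transformedConnection (d' : ι → Derivation ℝ B B) (ψ : A →ₐ[ℝ] B) (J K : Matrix ι ι B)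
    (Γ : ι → Matrix ι ι A) (a : ι) : Matrix ι ι B :=
  K * ((∑ i, J i a • (Γ i).map ψ) * J + matDeriv (d' a) J)

lemma mul_transformedConnection (hJ : J * K = 1) (a : ι) :
    J * transformedConnection d' ψ J K Γ a =
      (∑ i, J i a • (Γ i).map ψ) * J + matDeriv (d' a) J := by
  rw [transformedConnection, ← mul_assoc, hJ, one_mul]

/-- `hψ` is the chain rule and `hJs` the symmetry of second derivatives of the coordinate change.
The latter makes the inhomogeneous term `J⁻¹ dJ` symmetric, so torsion-freeness survives. -/
lemma IsLeviCivita.transform (h : IsLeviCivita d g Γ) (hg : gᵀ = g)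
    (hψ : ∀ a f, d' a (ψ f) = ∑ i, J i a * ψ (d i f)) (hJ : J * K = 1)
    (hJs : ∀ a b i, d' a (J i b) = d' b (J i a)) :
    IsLeviCivita d' (Jᵀ * g.map ψ * J) (transformedConnection d' ψ J K Γ) := by
  refine ⟨fun a b k ↦ ?_, fun a ↦ ?_⟩
  · simp only [transformedConnection, mul_apply (M := K)]
    refine Finset.sum_congr rfl fun l _ ↦ ?_
    congr 1
    simp only [Matrix.add_apply, matDeriv_apply, hJs a b]
    congr 1
    simp only [mul_apply, Matrix.sum_apply, Matrix.smul_apply, map_apply, smul_eq_mul, Finset.sum_mul]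
    rw [Finset.sum_comm]
    refine Finset.sum_congr rfl fun i _ ↦ Finset.sum_congr rfl fun j _ ↦ ?_
    rw [h.symm i j]; ring
  · have hC : (∑ i, J i a • (matDeriv (d i) g).map ψ) =
        g.map ψ * (∑ i, J i a • (Γ i).map ψ) + (g.map ψ * (∑ i, J i a • (Γ i).map ψ))ᵀ := by
      rw [Finset.mul_sum, transpose_sum, ← Finset.sum_add_distrib]
      refine Finset.sum_congr rfl fun i _ ↦ ?_
      rw [h.compat, Matrix.mul_smul, transpose_smul, ← smul_add, ← Matrix.map_mul,
        Matrix.map_add _ (map_add ψ), ← transpose_map]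
    have hs : (g.map ψ)ᵀ = g.map ψ := by rw [← transpose_map, hg]
    rw [matDeriv_mul, matDeriv_mul, matDeriv_map (hψ a), hC, matDeriv_transpose, mul_assoc _ J,
      mul_transformedConnection hJ]
    generalize (∑ i, J i a • (Γ i).map ψ) = C
    simp only [transpose_mul, transpose_add, transpose_transpose, hs]
    noncomm_ring

-- Curvature commutes with pull-back of connection forms: the terms containing derivatives of `J`
-- are symmetric in `a`, `b` by `hJs` and cancel.
omit [DecidableEq ι] in
lemma curvature_sum_smul (hψ : ∀ a f, d' a (ψ f) = ∑ i, J i a * ψ (d i f))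
    (hJs : ∀ a b i, d' a (J i b) = d' b (J i a)) (a b : ι) :
    curvature d' (fun a ↦ ∑ i, J i a • (Γ i).map ψ) a b =
      ∑ i, ∑ j, (J i a * J j b) • (curvature d Γ i j).map ψ := by
  have key : ∀ a b, matDeriv (d' a) (∑ j, J j b • (Γ j).map ψ) =
      ∑ j, d' a (J j b) • (Γ j).map ψ +
        ∑ i, ∑ j, (J i a * J j b) • (matDeriv (d i) (Γ j)).map ψ := by
    intro a b
    rw [matDeriv_sum, Finset.sum_comm, ← Finset.sum_add_distrib]
    refine Finset.sum_congr rfl fun j _ ↦ ?_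
    rw [matDeriv_smul, matDeriv_map (hψ a), Finset.smul_sum]
    congr 1
    exact Finset.sum_congr rfl fun i _ ↦ by rw [smul_smul, mul_comm]
  have hm : ∀ a b, (∑ i, J i a • (Γ i).map ψ) * (∑ i, J i b • (Γ i).map ψ) =
      ∑ i, ∑ j, (J i a * J j b) • (Γ i * Γ j).map ψ := by
    intro a b
    rw [Finset.sum_mul_sum]
    refine Finset.sum_congr rfl fun i _ ↦ Finset.sum_congr rfl fun j _ ↦ ?_
    rw [Matrix.smul_mul, Matrix.mul_smul, smul_smul, Matrix.map_mul]
  have hsw : ∀ X : ι → ι → Matrix ι ι A, ∑ i, ∑ j, (J i b * J j a) • (X i j).map ψ =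
      ∑ i, ∑ j, (J i a * J j b) • (X j i).map ψ := fun X ↦ by
    rw [Finset.sum_comm]
    exact Finset.sum_congr rfl fun i _ ↦ Finset.sum_congr rfl fun j _ ↦ by rw [mul_comm]
  rw [curvature, key, key, hm, hm, hsw, hsw]
  simp only [hJs b a]
  rw [add_sub_add_left_eq_sub, ← Finset.sum_sub_distrib, ← Finset.sum_sub_distrib,
    ← Finset.sum_add_distrib]
  refine Finset.sum_congr rfl fun i _ ↦ ?_
  rw [← Finset.sum_sub_distrib, ← Finset.sum_sub_distrib, ← Finset.sum_add_distrib]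
  refine Finset.sum_congr rfl fun j _ ↦ ?_
  rw [curvature, Matrix.map_add _ (map_add ψ), Matrix.map_sub _ (map_sub ψ),
    Matrix.map_sub _ (map_sub ψ), smul_add, smul_sub, smul_sub]

/-- Gauge covariance `F' = J⁻¹ F J`, multiplied by `J` on the left so that the inverse `K` never has
to be differentiated. -/
lemma mul_curvature_transformedConnection
    (hψ : ∀ a f, d' a (ψ f) = ∑ i, J i a * ψ (d i f)) (hJ : J * K = 1)
    (hd' : ∀ a b f, d' a (d' b f) = d' b (d' a f))
    (hJs : ∀ a b i, d' a (J i b) = d' b (J i a)) (a b : ι) :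
    J * curvature d' (transformedConnection d' ψ J K Γ) a b =
      (∑ i, ∑ j, (J i a * J j b) • (curvature d Γ i j).map ψ) * J := by
  rw [← curvature_sum_smul hψ hJs, curvature, curvature]
  have hm := fun a ↦ mul_transformedConnection (d' := d') (ψ := ψ) (Γ := Γ) hJ a
  have hdm : ∀ a b, J * matDeriv (d' a) (transformedConnection d' ψ J K Γ b) =
      matDeriv (d' a) ((∑ i, J i b • (Γ i).map ψ) * J + matDeriv (d' b) J) -
        matDeriv (d' a) J * transformedConnection d' ψ J K Γ b := by
    intro a b
    rw [← hm, matDeriv_mul]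
    abel
  simp only [mul_add, mul_sub, hdm, ← mul_assoc, hm]
  simp only [matDeriv_add, matDeriv_mul, add_mul, mul_assoc, hm, matDeriv_comm (hd' b a)]
  noncomm_ring

/-- The trace over the form index `a` and the upper index pairs one factor `J` with one factor `K`;
they cancel, and two factors `J` remain. -/
lemma ricciOf_transformedConnection
    (hψ : ∀ a f, d' a (ψ f) = ∑ i, J i a * ψ (d i f)) (hJ : J * K = 1)
    (hd' : ∀ a b f, d' a (d' b f) = d' b (d' a f))
    (hJs : ∀ a b i, d' a (J i b) = d' b (J i a)) :
    ricciOf d' (transformedConnection d' ψ J K Γ) = Jᵀ * (ricciOf d Γ).map ψ * J := by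
  have hKJ : K * J = 1 := mul_eq_one_comm.mp hJ
  ext b k
  let M : ι → Matrix ι ι B := fun i ↦ (∑ j, J j b • (curvature d Γ i j).map ψ) * J
  have hc : ∀ a, curvature d' (transformedConnection d' ψ J K Γ) a b a k =
      ∑ i, J i a * (K * M i) a k := fun a ↦ by
    have : curvature d' (transformedConnection d' ψ J K Γ) a b = ∑ i, J i a • (K * M i) := by
      rw [← one_mul (curvature _ _ _ _), ← hKJ, mul_assoc,
        mul_curvature_transformedConnection hψ hJ hd' hJs, Finset.sum_mul, Finset.mul_sum]
      refine Finset.sum_congr rfl fun i _ ↦ ?_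
      simp only [M, mul_smul, ← Finset.smul_sum, Matrix.smul_mul, Matrix.mul_smul]
    rw [this, Matrix.sum_apply]
    rfl
  have hM : ∀ i, ∑ a, J i a * (K * M i) a k = M i i k := fun i ↦ by
    rw [← mul_apply, ← mul_assoc, hJ, one_mul]
  rw [ricciOf, of_apply, Finset.sum_congr rfl fun a _ ↦ hc a, Finset.sum_comm,
    Finset.sum_congr rfl fun i _ ↦ hM i, mul_apply]
  simp only [M, mul_apply, Matrix.sum_apply, Matrix.smul_apply, map_apply, smul_eq_mul, ricciOf,
    of_apply, transpose_apply, map_sum, Finset.sum_mul, Finset.mul_sum]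
  rw [Finset.sum_comm]
  conv_rhs => rw [Finset.sum_comm]
  exact Finset.sum_congr rfl fun _ _ ↦ Finset.sum_comm

lemma scalarOf_transformedConnection
    (hψ : ∀ a f, d' a (ψ f) = ∑ i, J i a * ψ (d i f)) (hJ : J * K = 1)
    (hd' : ∀ a b f, d' a (d' b f) = d' b (d' a f))
    (hJs : ∀ a b i, d' a (J i b) = d' b (J i a)) :
    scalarOf d' (K * Q.map ψ * Kᵀ) (transformedConnection d' ψ J K Γ) = ψ (scalarOf d Q Γ) := by
  have htr : ∀ {C : Type _} [CommRing C] (X Y : Matrix ι ι C),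
    ∑ i, ∑ k, X i k * Y i k = (X * Yᵀ).trace := fun X Y ↦ by simp [trace, mul_apply]
  have hKJ : K * J = 1 := mul_eq_one_comm.mp hJ
  have hKJ' : Kᵀ * Jᵀ = 1 := by rw [← transpose_mul, hJ, transpose_one]
  have h1 : ψ (scalarOf d Q Γ) = ∑ i, ∑ k, Q.map ψ i k * (ricciOf d Γ).map ψ i k := by
    simp [scalarOf]
  rw [h1, scalarOf, htr, htr, ricciOf_transformedConnection hψ hJ hd' hJs]
  simp only [transpose_mul, transpose_transpose, mul_assoc]
  rw [← mul_assoc Kᵀ, hKJ', one_mul, trace_mul_comm]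
  simp only [mul_assoc, hJ, mul_one]

end Covariance
end Algebra

/-! ### Bianchi identities, variation formulas and the evolution equation of the scalar curvature.
-/

section Evolution

open Matrix

variable {ι : Type*} [Fintype ι] {A : Type*} [CommRing A] [Algebra ℝ A]
  {d : ι → Derivation ℝ A A} {g Q : Matrix ι ι A} {Γ : ι → Matrix ι ι A}

lemma eq_zero_of_eq_neg {a : A} (h : a = -a) : a = 0 := by
  linear_combination algebraMap ℝ A (1 / 2) * h - a * algebraMap_half_mul_two (A := A)

lemma curvature_swap (i j : ι) : curvature d Γ i j = -curvature d Γ j i := by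
  simp only [curvature]; abel

/-- The second Bianchi identity. -/
lemma bianchi (hd : ∀ i j f, d i (d j f) = d j (d i f)) (i j k : ι) :
    (matDeriv (d k) (curvature d Γ i j) + (Γ k * curvature d Γ i j - curvature d Γ i j * Γ k)) +
    (matDeriv (d i) (curvature d Γ j k) + (Γ i * curvature d Γ j k - curvature d Γ j k * Γ i)) +
    (matDeriv (d j) (curvature d Γ k i) + (Γ j * curvature d Γ k i - curvature d Γ k i * Γ j)) =
      0 := by
  simp only [curvature, matDeriv_add, matDeriv_sub, matDeriv_mul]
  rw [matDeriv_comm (hd k i), matDeriv_comm (hd k j), matDeriv_comm (hd j i)]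
  noncomm_ring

/-- Commuting two derivatives of `g`, each expressed through metric compatibility, leaves exactly
the symmetric part of the lowered curvature. -/
lemma mul_curvature_antisymm (hd : ∀ i j f, d i (d j f) = d j (d i f)) (h : IsLeviCivita d g Γ)
    (hg : gᵀ = g) (i j : ι) : (g * curvature d Γ i j)ᵀ = -(g * curvature d Γ i j) := by
  have e : ∀ i j, matDeriv (d i) (matDeriv (d j) g) =
      (g * Γ i + (g * Γ i)ᵀ) * Γ j + g * matDeriv (d i) (Γ j) +
        ((g * Γ i + (g * Γ i)ᵀ) * Γ j + g * matDeriv (d i) (Γ j))ᵀ := fun i j ↦ by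
    rw [h.compat j, matDeriv_add, matDeriv_transpose, matDeriv_mul, h.compat i]
  have := matDeriv_comm (hd i j) g
  rw [e, e, ← sub_eq_zero] at this
  rw [eq_neg_iff_add_eq_zero, ← this]
  simp only [curvature, transpose_mul, transpose_add, transpose_sub, transpose_transpose, hg]
  noncomm_ring

variable [DecidableEq ι]

lemma matDeriv_of_mul_eq_one (D : Derivation ℝ A A) (hQ : Q * g = 1) :
    matDeriv D Q = -(Q * matDeriv D g * Q) := by
  have hgQ : g * Q = 1 := mul_eq_one_comm.mp hQ
  have h0 : matDeriv D Q * g + Q * matDeriv D g = 0 := by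
    rw [← matDeriv_mul, hQ, matDeriv_one]
  have : (matDeriv D Q * g + Q * matDeriv D g) * Q = 0 := by rw [h0, zero_mul]
  rw [add_mul, mul_assoc, hgQ, mul_one] at this
  exact eq_neg_of_add_eq_zero_left this

omit [Algebra ℝ A] in
lemma transpose_inverse (hg : gᵀ = g) (hQ : Q * g = 1) : Qᵀ = Q := by
  have h : Qᵀ * g = 1 := by
    rw [← hg, ← transpose_mul, mul_eq_one_comm.mp hQ, transpose_one]
  calc Qᵀ = Qᵀ * (g * Q) := by rw [mul_eq_one_comm.mp hQ, mul_one]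
    _ = Q := by rw [← mul_assoc, h, one_mul]

/-- The inverse metric is parallel. -/
lemma IsLeviCivita.matDeriv_inverse (h : IsLeviCivita d g Γ) (hg : gᵀ = g) (hQ : Q * g = 1)
    (i : ι) : matDeriv (d i) Q = -(Γ i * Q + Q * (Γ i)ᵀ) := by
  rw [matDeriv_of_mul_eq_one _ hQ, h.compat, mul_add, add_mul, transpose_mul, hg,
    ← mul_assoc Q, hQ, one_mul, mul_assoc Q (_ * g), mul_assoc _ g, mul_eq_one_comm.mp hQ, mul_one]

lemma IsLeviCivita.deriv_inverse_apply (h : IsLeviCivita d g Γ) (hg : gᵀ = g) (hQ : Q * g = 1)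
    (i a b : ι) :
    d i (Q a b) = -(∑ m, Γ i a m * Q m b + ∑ m, Q a m * Γ i b m) := by
  have := congrFun₂ (h.matDeriv_inverse hg hQ i) a b
  simpa only [matDeriv_apply, Matrix.neg_apply, Matrix.add_apply, mul_apply, transpose_apply]
    using this

/-- The right-hand side is the logarithmic derivative of `det g`, written as a trace so that no
determinant appears. -/
lemma IsLeviCivita.two_mul_trace (h : IsLeviCivita d g Γ) (hg : gᵀ = g) (hQ : Q * g = 1) (i : ι) :
    2 * (Γ i).trace = (Q * matDeriv (d i) g).trace := by
  have h1 : (Q * (g * Γ i)ᵀ).trace = (Γ i).trace := by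
    rw [← trace_transpose, transpose_mul, transpose_transpose, transpose_inverse hg hQ,
      trace_mul_comm, ← mul_assoc, hQ, one_mul]
  rw [h.compat, mul_add, trace_add, h1, ← mul_assoc, hQ, one_mul, two_mul]

/-- The variation of `Γᵐₘᵢ`. -/
lemma IsLeviCivita.two_mul_deriv_trace (h : IsLeviCivita d g Γ) (hg : gᵀ = g) (hQ : Q * g = 1)
    {δ : Derivation ℝ A A} (hδ : ∀ i f, δ (d i f) = d i (δ f)) (i : ι) :
    2 * δ (Γ i).trace = d i (Q * matDeriv δ g).trace := by
  have h1 : δ (2 * (Γ i).trace) = 2 * δ (Γ i).trace := by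
    rw [two_mul, map_add, two_mul]
  rw [← h1, h.two_mul_trace hg hQ, ← trace_matDeriv, ← trace_matDeriv, matDeriv_mul, matDeriv_mul,
    matDeriv_comm (hδ i), trace_add, trace_add, matDeriv_of_mul_eq_one δ hQ,
    matDeriv_of_mul_eq_one (d i) hQ]
  -- The first-order terms `Q ∂g Q δg` coming from the two derivatives of `Q` agree after a cyclic
  -- permutation under the trace.
  congr 1
  rw [neg_mul, neg_mul, trace_neg, trace_neg, mul_assoc, trace_mul_comm, ← mul_assoc]

/-- The divergence `∇ⱼ Xˡʲ` of a tensor with two upper indices. -/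
def divergence (d : ι → Derivation ℝ A A) (Γ : ι → Matrix ι ι A) (X : Matrix ι ι A) (l : ι) : A :=
  ∑ j, d j (X l j) + ∑ j, ∑ m, Γ j l m * X m j + ∑ j, (Γ j).trace * X l j

/-- The divergence `∇ⱼ Yʲ` of a vector field. -/
def vectorDivergence (d : ι → Derivation ℝ A A) (Γ : ι → Matrix ι ι A) (Y : ι → A) : A :=
  ∑ j, (d j (Y j) + (Γ j).trace * Y j)

omit [DecidableEq ι] in
lemma divergence_add (X Y : Matrix ι ι A) (l : ι) :
    divergence d Γ (X + Y) l = divergence d Γ X l + divergence d Γ Y l := by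
  simp only [divergence, Matrix.add_apply, map_add, mul_add, Finset.sum_add_distrib]
  ring

omit [DecidableEq ι] in
lemma divergence_smul (a : A) (X : Matrix ι ι A) (l : ι) :
    divergence d Γ (a • X) l = a * divergence d Γ X l + ∑ j, X l j * d j a := by
  simp only [divergence, Matrix.smul_apply, smul_eq_mul, Derivation.leibniz, mul_add,
    Finset.sum_add_distrib, Finset.mul_sum, mul_left_comm _ a]
  ring

omit [DecidableEq ι] in
lemma IsLeviCivita.trace_eq (h : IsLeviCivita d g Γ) (i : ι) : (Γ i).trace = ∑ j, Γ j j i := by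
  simp only [trace, diag_apply, fun j ↦ h.symm i j j]

lemma IsLeviCivita.divergence_inverse (h : IsLeviCivita d g Γ) (hg : gᵀ = g) (hQ : Q * g = 1)
    (l : ι) : divergence d Γ Q l = 0 := by
  have h1 : ∑ j, ∑ m, Q l m * Γ j j m = ∑ j, (Γ j).trace * Q l j := by
    rw [Finset.sum_comm]
    refine Finset.sum_congr rfl fun m _ ↦ ?_
    rw [h.trace_eq, ← Finset.mul_sum, mul_comm]
  simp only [divergence, h.deriv_inverse_apply hg hQ, Finset.sum_neg_distrib,
    Finset.sum_add_distrib, h1]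
  ring

set_option maxHeartbeats 400000 in
/-- The contracted second Bianchi identity. -/
lemma IsLeviCivita.contracted_bianchi (h : IsLeviCivita d g Γ) (hg : gᵀ = g) (hQ : Q * g = 1)
    (hd : ∀ i j f, d i (d j f) = d j (d i f)) (k : ι) :
    d k (scalarOf d Q Γ) + 2 * ∑ i, ∑ m, Γ k i m * (ricciOf d Γ * Q) i m =
      2 * ∑ i, d i ((ricciOf d Γ * Q) k i) + 2 * ∑ i, (Γ i).trace * (ricciOf d Γ * Q) k i := by
  have hQs := transpose_inverse hg hQ
  -- With one index raised, the curvature is antisymmetric in both pairs of indices, so each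
  -- contraction is a Ricci term up to sign.
  set T : ι → ι → Matrix ι ι A := fun i j ↦ curvature d Γ i j * Q with hT
  have hTT : ∀ i j a b, T i j a b = -T i j b a := by
    intro i j a b
    have h1 : T i j = Q * (g * curvature d Γ i j) * Q := by rw [← mul_assoc, hQ, one_mul]
    have h2 : (T i j)ᵀ = - T i j := by
      rw [h1, transpose_mul, transpose_mul, hQs, mul_curvature_antisymm hd h hg]
      noncomm_ring
    have := congrFun₂ h2 b a
    rwa [transpose_apply] at this
  have hTs : ∀ i j a b, T i j a b = -T j i a b := by
    intro i j a b
    simp only [hT]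
    rw [curvature_swap, neg_mul, Matrix.neg_apply]
  have hP : ∀ k b, (ricciOf d Γ * Q) k b = ∑ j, T j k j b := by
    intro k b
    simp only [hT, mul_apply, ricciOf, of_apply, Finset.sum_mul]
    exact Finset.sum_comm
  have hR : scalarOf d Q Γ = ∑ j, ∑ i, T i j i j := by
    simp only [scalarOf, ← hP, mul_apply]
    refine Finset.sum_congr rfl fun i _ ↦ Finset.sum_congr rfl fun j _ ↦ ?_
    rw [mul_comm, ← congrFun₂ hQs i j, transpose_apply]
  have hD : ∀ i j k, matDeriv (d k) (T i j) = (matDeriv (d k) (curvature d Γ i j) +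
      (Γ k * curvature d Γ i j - curvature d Γ i j * Γ k)) * Q - Γ k * T i j - T i j * (Γ k)ᵀ := by
    intro i j k
    simp only [hT, matDeriv_mul, h.matDeriv_inverse hg hQ]
    noncomm_ring
  have hB : ∀ i j, (matDeriv (d k) (T i j) + Γ k * T i j + T i j * (Γ k)ᵀ) +
      (matDeriv (d i) (T j k) + Γ i * T j k + T j k * (Γ i)ᵀ) +
      (matDeriv (d j) (T k i) + Γ j * T k i + T k i * (Γ j)ᵀ) = 0 := by
    intro i j
    rw [hD, hD, hD, ← zero_mul Q, ← bianchi hd i j k]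
    noncomm_ring
  -- The upper indices are contracted with the form indices `i`, `j`. Of the nine resulting sums,
  -- `t6` and `t8` vanish, being contractions of a symmetric `Γ` with an antisymmetric `T`.
  have hS : ∑ i, ∑ j, ((d k (T i j i j) + ∑ m, Γ k i m * T i j m j + ∑ m, T i j i m * Γ k j m) +
      (d i (T j k i j) + ∑ m, Γ i i m * T j k m j + ∑ m, T j k i m * Γ i j m) +
      (d j (T k i i j) + ∑ m, Γ j i m * T k i m j + ∑ m, T k i i m * Γ j j m)) = 0 := by
    refine Finset.sum_eq_zero fun i _ ↦ Finset.sum_eq_zero fun j _ ↦ ?_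
    have := congrFun₂ (hB i j) i j
    simpa only [Matrix.add_apply, matDeriv_apply, mul_apply, transpose_apply, Matrix.zero_apply]
      using this
  have t1 : ∑ i, ∑ j, d k (T i j i j) = d k (scalarOf d Q Γ) := by
    rw [hR, Finset.sum_comm]; simp only [map_sum]
  have t2 : ∑ i, ∑ j, ∑ m, Γ k i m * T i j m j = ∑ i, ∑ m, Γ k i m * (ricciOf d Γ * Q) i m := by
    refine Finset.sum_congr rfl fun i _ ↦ ?_
    rw [Finset.sum_comm]
    refine Finset.sum_congr rfl fun m _ ↦ ?_
    rw [hP, Finset.mul_sum]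
    exact Finset.sum_congr rfl fun j _ ↦ by rw [hTT, hTs, neg_neg]
  have t3 : ∑ i, ∑ j, ∑ m, T i j i m * Γ k j m = ∑ i, ∑ m, Γ k i m * (ricciOf d Γ * Q) i m := by
    rw [Finset.sum_comm]
    refine Finset.sum_congr rfl fun j _ ↦ ?_
    rw [Finset.sum_comm]
    refine Finset.sum_congr rfl fun m _ ↦ ?_
    rw [hP, Finset.mul_sum]
    exact Finset.sum_congr rfl fun j _ ↦ mul_comm _ _
  have t4 : ∑ i, ∑ j, d i (T j k i j) = -∑ i, d i ((ricciOf d Γ * Q) k i) := by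
    simp only [hP, map_sum, ← Finset.sum_neg_distrib]
    refine Finset.sum_congr rfl fun i _ ↦ Finset.sum_congr rfl fun j _ ↦ ?_
    rw [hTT, map_neg]
  have t5 : ∑ i, ∑ j, ∑ m, Γ i i m * T j k m j = -∑ i, (Γ i).trace * (ricciOf d Γ * Q) k i := by
    simp only [hP, h.trace_eq, Finset.sum_mul_sum, ← Finset.sum_neg_distrib]
    rw [Finset.sum_congr rfl fun i _ ↦ Finset.sum_comm, Finset.sum_comm]
    refine Finset.sum_congr rfl fun m _ ↦ Finset.sum_congr rfl fun i _ ↦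
      Finset.sum_congr rfl fun j _ ↦ ?_
    rw [hTT, mul_neg]
  have t6 : ∑ i, ∑ j, ∑ m, T j k i m * Γ i j m = 0 := by
    refine eq_zero_of_eq_neg ?_
    rw [Finset.sum_congr rfl fun i _ ↦ Finset.sum_comm, Finset.sum_comm]
    simp only [← Finset.sum_neg_distrib]
    rw [Finset.sum_congr rfl fun i _ ↦ Finset.sum_congr rfl fun j _ ↦ Finset.sum_congr rfl
      fun m _ ↦ show T m k j i * Γ j m i = -(T m k i j * Γ i m j) by rw [hTT, h.symm j i]; ring]
    exact Finset.sum_comm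
  have t7 : ∑ i, ∑ j, d j (T k i i j) = -∑ i, d i ((ricciOf d Γ * Q) k i) := by
    simp only [hP, map_sum, ← Finset.sum_neg_distrib]
    rw [Finset.sum_comm]
    refine Finset.sum_congr rfl fun i _ ↦ Finset.sum_congr rfl fun j _ ↦ ?_
    rw [hTs, map_neg]
  have t8 : ∑ i, ∑ j, ∑ m, Γ j i m * T k i m j = 0 := by
    refine eq_zero_of_eq_neg ?_
    simp only [← Finset.sum_neg_distrib]
    refine Finset.sum_congr rfl fun i _ ↦ ?_
    rw [Finset.sum_comm]
    refine Finset.sum_congr rfl fun j _ ↦ Finset.sum_congr rfl fun m _ ↦ ?_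
    rw [hTT, h.symm m j]; ring
  have t9 : ∑ i, ∑ j, ∑ m, T k i i m * Γ j j m = -∑ i, (Γ i).trace * (ricciOf d Γ * Q) k i := by
    simp only [hP, h.trace_eq, Finset.sum_mul_sum, ← Finset.sum_neg_distrib]
    rw [Finset.sum_comm, Finset.sum_congr rfl fun i _ ↦ Finset.sum_comm, Finset.sum_comm]
    refine Finset.sum_congr rfl fun m _ ↦ Finset.sum_congr rfl fun i _ ↦
      Finset.sum_congr rfl fun j _ ↦ ?_
    rw [hTs]; ring
  simp only [Finset.sum_add_distrib] at hS
  rw [t1, t2, t3, t4, t5, t6, t7, t8, t9] at hS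
  linear_combination hS

/-- The contracted Bianchi identity with both indices raised; raising passes through the divergence
because `Q` is parallel. -/
lemma IsLeviCivita.two_mul_divergence_ricci (h : IsLeviCivita d g Γ) (hg : gᵀ = g)
    (hQ : Q * g = 1) (hd : ∀ i j f, d i (d j f) = d j (d i f)) (l : ι) :
    2 * divergence d Γ (Q * (ricciOf d Γ * Q)) l = ∑ k, Q l k * d k (scalarOf d Q Γ) := by
  set P := ricciOf d Γ * Q with hP
  have h1 : ∑ j, d j ((Q * P) l j) = ∑ k, Q l k * ∑ j, d j (P k j) -
      ∑ j, ∑ m, Γ j l m * (Q * P) m j - ∑ k, Q l k * ∑ i, ∑ m, Γ k i m * P i m := by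
    have e : ∀ j, d j ((Q * P) l j) = ∑ k, Q l k * d j (P k j) -
        ∑ m, Γ j l m * (Q * P) m j - ∑ k, ∑ m, Q l m * Γ j k m * P k j := by
      intro j
      have := congrFun₂ (matDeriv_mul (d j) Q P) l j
      rw [matDeriv_apply] at this
      rw [this, h.matDeriv_inverse hg hQ, neg_mul, add_mul, mul_assoc]
      simp only [Matrix.add_apply, Matrix.neg_apply, mul_apply, matDeriv_apply, transpose_apply,
        Finset.sum_mul]
      ring
    simp only [e, Finset.sum_sub_distrib, Finset.mul_sum]
    congr 1
    · congr 1
      exact Finset.sum_comm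
    · rw [Finset.sum_congr rfl fun i _ ↦ Finset.sum_comm, Finset.sum_comm]
      refine Finset.sum_congr rfl fun k _ ↦ ?_
      rw [Finset.sum_comm]
      refine Finset.sum_congr rfl fun i _ ↦ Finset.sum_congr rfl fun m _ ↦ ?_
      rw [h.symm m k, mul_assoc]
  have h2 : ∑ j, (Γ j).trace * (Q * P) l j = ∑ k, Q l k * ∑ i, (Γ i).trace * P k i := by
    simp only [mul_apply, Finset.mul_sum]
    rw [Finset.sum_comm]
    exact Finset.sum_congr rfl fun _ _ ↦ Finset.sum_congr rfl fun _ _ ↦ by ring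
  rw [divergence, h1, h2, sub_right_comm, sub_add_cancel, ← Finset.sum_sub_distrib,
    ← Finset.sum_add_distrib, Finset.mul_sum]
  refine Finset.sum_congr rfl fun k _ ↦ ?_
  linear_combination (-Q l k) * h.contracted_bianchi hg hQ hd k

/-- Obtained by applying `δ` to `divergence d Γ Q = 0`. The traced variation of `Γ` follows without
a formula for `δ Γ` itself. -/
lemma IsLeviCivita.sum_inverse_mul_deriv (h : IsLeviCivita d g Γ) (hg : gᵀ = g) (hQ : Q * g = 1)
    {δ : Derivation ℝ A A} (hδ : ∀ i f, δ (d i f) = d i (δ f)) (l : ι) :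
    ∑ j, ∑ m, δ (Γ j l m) * Q m j =
      -divergence d Γ (matDeriv δ Q) l - ∑ j, Q l j * δ (Γ j).trace := by
  have := congrArg δ (h.divergence_inverse hg hQ l)
  simp only [divergence, map_add, map_sum, Derivation.leibniz, smul_eq_mul, hδ, map_zero,
    Finset.sum_add_distrib] at this
  simp only [divergence, matDeriv_apply, mul_comm (δ _) (Q _ _)]
  linear_combination this

/-- The variation of the Ricci tensor, traced with the inverse metric. -/
lemma IsLeviCivita.sum_inverse_mul_deriv_ricci (h : IsLeviCivita d g Γ) (hg : gᵀ = g)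
    (hQ : Q * g = 1) {δ : Derivation ℝ A A} (hδ : ∀ i f, δ (d i f) = d i (δ f)) :
    ∑ i, ∑ k, Q i k * δ (ricciOf d Γ i k) =
      vectorDivergence d Γ (fun l ↦ ∑ j, ∑ m, δ (Γ j l m) * Q m j) -
        vectorDivergence d Γ (fun l ↦ ∑ j, Q l j * δ (Γ j).trace) := by
  have hQs : ∀ a b, Q a b = Q b a := fun a b ↦ congrFun₂ (transpose_inverse hg hQ) b a
  -- Palatini's formula written out. `hW` and `hU` below expand the two divergences, where
  -- parallelism of `Q` turns its derivatives into the `Γ · δΓ` terms.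
  have hF : ∀ i k, δ (ricciOf d Γ i k) =
      (∑ j, d j (δ (Γ i j k)) + ∑ j, ∑ m, Γ j j m * δ (Γ i m k) -
        ∑ j, ∑ m, δ (Γ i j m) * Γ j m k) -
      (d i (δ (∑ j, Γ j j k)) + ∑ j, ∑ m, Γ i j m * δ (Γ j m k) -
        ∑ j, ∑ m, δ (Γ j j m) * Γ i m k) := by
    intro i k
    simp only [ricciOf, of_apply, curvature, Matrix.sub_apply, Matrix.add_apply, matDeriv_apply,
      mul_apply, map_sum, map_add, map_sub, hδ, Derivation.leibniz, smul_eq_mul,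
      Finset.sum_add_distrib, Finset.sum_sub_distrib, mul_comm (δ _)]
    ring
  have hU : vectorDivergence d Γ (fun l ↦ ∑ j, Q l j * δ (Γ j).trace) =
      ∑ i, ∑ k, Q i k * (d i (δ (Γ k).trace) - ∑ m, δ (Γ m).trace * Γ i m k) := by
    have h1 : ∀ k, ∑ i, d i (Q i k) + ∑ i, (Γ i).trace * Q i k =
        -∑ i, ∑ m, Γ i k m * Q m i := fun k ↦ by
      have := h.divergence_inverse hg hQ k
      simp only [divergence, hQs k] at this
      linear_combination this
    have h2 : ∑ k, (∑ i, d i (Q i k) + ∑ i, (Γ i).trace * Q i k) * δ (Γ k).trace =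
        -∑ i, ∑ k, Q i k * ∑ m, δ (Γ m).trace * Γ i m k := by
      simp only [h1, neg_mul, Finset.sum_neg_distrib, Finset.sum_mul, Finset.mul_sum]
      congr 1
      rw [Finset.sum_comm]
      refine Finset.sum_congr rfl fun i _ ↦ ?_
      rw [Finset.sum_comm]
      exact Finset.sum_congr rfl fun j _ ↦ Finset.sum_congr rfl fun m _ ↦ by
        rw [hQs j i]; ring
    simp only [add_mul, Finset.sum_add_distrib, Finset.sum_mul] at h2
    simp only [vectorDivergence, map_sum, Derivation.leibniz, smul_eq_mul, mul_sub,
      Finset.sum_sub_distrib, Finset.sum_add_distrib, Finset.mul_sum] at h2 ⊢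
    rw [sub_eq_add_neg, ← h2, add_assoc]
    congr 1
    rw [Finset.sum_comm]
    congr 1
    · exact Finset.sum_congr rfl fun _ _ ↦ Finset.sum_congr rfl fun _ _ ↦ mul_comm _ _
    · rw [Finset.sum_comm]
      exact Finset.sum_congr rfl fun _ _ ↦ Finset.sum_congr rfl fun _ _ ↦ (mul_assoc _ _ _).symm
  have hW : vectorDivergence d Γ (fun l ↦ ∑ j, ∑ m, δ (Γ j l m) * Q m j) =
      ∑ i, ∑ k, Q i k * (∑ j, d j (δ (Γ i j k)) + ∑ j, ∑ m, Γ j j m * δ (Γ i m k) -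
        ∑ j, ∑ m, δ (Γ i j m) * Γ j m k - ∑ j, ∑ m, Γ i j m * δ (Γ j m k)) := by
    have rot : ∀ f : ι → ι → ι → A,
        ∑ a, ∑ b, ∑ c, f a b c = ∑ b, ∑ c, ∑ a, f a b c := fun f ↦ by
      rw [Finset.sum_comm]
      exact Finset.sum_congr rfl fun _ _ ↦ Finset.sum_comm
    have w1 : ∑ l, ∑ j, ∑ m, Q m j * d l (δ (Γ j l m)) =
        ∑ i, ∑ k, Q i k * ∑ j, d j (δ (Γ i j k)) := by
      rw [rot]
      simp only [Finset.mul_sum]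
      exact Finset.sum_congr rfl fun i _ ↦ Finset.sum_congr rfl fun k _ ↦
        Finset.sum_congr rfl fun _ _ ↦ by rw [hQs k i]
    have w2 : ∑ l, ∑ j, ∑ m, (Γ l).trace * (δ (Γ j l m) * Q m j) =
        ∑ i, ∑ k, Q i k * ∑ j, ∑ m, Γ j j m * δ (Γ i m k) := by
      rw [rot]
      refine Finset.sum_congr rfl fun i _ ↦ Finset.sum_congr rfl fun k _ ↦ ?_
      rw [Finset.sum_comm, Finset.mul_sum]
      refine Finset.sum_congr rfl fun m _ ↦ ?_
      rw [← Finset.sum_mul, ← h.trace_eq, hQs k i]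
      ring
    have w3 : ∑ l, ∑ j, ∑ m, δ (Γ j l m) * ∑ p, Γ l m p * Q p j =
        ∑ i, ∑ k, Q i k * ∑ j, ∑ m, δ (Γ i j m) * Γ j m k := by
      simp only [Finset.mul_sum]
      rw [Finset.sum_congr rfl fun _ _ ↦ Finset.sum_congr rfl fun _ _ ↦ Finset.sum_comm, rot]
      exact Finset.sum_congr rfl fun i _ ↦ Finset.sum_congr rfl fun k _ ↦
        Finset.sum_congr rfl fun _ _ ↦ Finset.sum_congr rfl fun _ _ ↦ by rw [hQs k i]; ring
    have w4 : ∑ l, ∑ j, ∑ m, δ (Γ j l m) * ∑ p, Q m p * Γ l j p =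
        ∑ i, ∑ k, Q i k * ∑ j, ∑ m, Γ i j m * δ (Γ j m k) := by
      simp only [Finset.mul_sum]
      rw [Finset.sum_congr rfl fun _ _ ↦ Finset.sum_congr rfl fun _ _ ↦ Finset.sum_comm, rot, rot]
      refine Finset.sum_congr rfl fun i _ ↦ ?_
      rw [rot, Finset.sum_comm]
      exact Finset.sum_congr rfl fun k _ ↦ Finset.sum_congr rfl fun j _ ↦
        Finset.sum_congr rfl fun m _ ↦ by rw [hQs k i, h.symm i m j]; ring
    have w5 : ∑ l, ∑ j, ∑ m, δ (Γ j l m) * d l (Q m j) =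
        -∑ l, ∑ j, ∑ m, δ (Γ j l m) * ∑ p, Γ l m p * Q p j -
          ∑ l, ∑ j, ∑ m, δ (Γ j l m) * ∑ p, Q m p * Γ l j p := by
      simp only [h.deriv_inverse_apply hg hQ, mul_neg, mul_add, Finset.sum_neg_distrib,
        Finset.sum_add_distrib]
      ring
    simp only [vectorDivergence, map_sum, Derivation.leibniz, smul_eq_mul, mul_sub, mul_add,
      Finset.sum_sub_distrib, Finset.sum_add_distrib]
    rw [w5, w3, w4, w1, ← w2]
    simp only [Finset.mul_sum]
    ring
  rw [hU, hW, ← Finset.sum_sub_distrib]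
  refine Finset.sum_congr rfl fun i _ ↦ ?_
  rw [← Finset.sum_sub_distrib]
  refine Finset.sum_congr rfl fun k _ ↦ ?_
  have h3 : ∑ j, ∑ m, δ (Γ j j m) * Γ i m k = ∑ m, δ (Γ m).trace * Γ i m k := by
    rw [Finset.sum_comm]
    simp only [h.trace_eq, map_sum, Finset.sum_mul]
  rw [hF, h3, h.trace_eq k]
  ring

/-- The evolution equation of the scalar curvature under the Ricci-Bourguignon flow. -/
theorem IsLeviCivita.evolution_scalar (h : IsLeviCivita d g Γ) (hg : gᵀ = g) (hQ : Q * g = 1)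
    (hd : ∀ i j f, d i (d j f) = d j (d i f))
    {δ : Derivation ℝ A A} (hδ : ∀ i f, δ (d i f) = d i (δ f)) (ρ : ℝ)
    (hflow : matDeriv δ g = (-2 : A) • ricciOf d Γ +
      (2 * algebraMap ℝ A ρ * scalarOf d Q Γ) • g) :
    δ (scalarOf d Q Γ) =
      algebraMap ℝ A (1 - 2 * ((Fintype.card ι : ℝ) - 1) * ρ) *
        vectorDivergence d Γ (fun l ↦ ∑ k, Q l k * d k (scalarOf d Q Γ)) +
      2 * ∑ i, ∑ k, (Q * (ricciOf d Γ * Q)) i k * ricciOf d Γ i k -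
      2 * algebraMap ℝ A ρ * scalarOf d Q Γ ^ 2 := by
  have hgQ : g * Q = 1 := mul_eq_one_comm.mp hQ
  set R := scalarOf d Q Γ with hR
  set r := algebraMap ℝ A ρ with hr
  set S := Q * (ricciOf d Γ * Q) with hS
  have h2r : algebraMap ℝ A 2 = 2 := map_ofNat _ 2
  have hdr : ∀ i, d i r = 0 := fun i ↦ (d i).map_algebraMap ρ
  have hδQ : matDeriv δ Q = (2 : A) • S + (-(2 * r * R)) • Q := by
    rw [matDeriv_of_mul_eq_one δ hQ, hflow, mul_add, add_mul, Matrix.mul_smul, Matrix.mul_smul,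
      Matrix.smul_mul, Matrix.smul_mul, hQ, one_mul, neg_add, neg_smul, neg_smul, neg_neg, hS,
      mul_assoc]
  have htr : (Q * matDeriv δ g).trace = -2 * R + 2 * r * R * Fintype.card ι := by
    have : R = (Q * ricciOf d Γ).trace := by
      rw [hR, scalarOf, trace_mul_comm, trace]
      simp only [diag_apply, mul_apply]
      refine Finset.sum_congr rfl fun i _ ↦ Finset.sum_congr rfl fun k _ ↦ ?_
      rw [mul_comm, ← congrFun₂ (transpose_inverse hg hQ) i k, transpose_apply]
    rw [hflow, mul_add, trace_add, Matrix.mul_smul, Matrix.mul_smul, trace_smul, trace_smul, hQ,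
      trace_one, ← this, smul_eq_mul, smul_eq_mul]
  set Y : ι → A := fun l ↦ ∑ k, Q l k * d k R with hY
  have hdiv : ∀ l, -divergence d Γ (matDeriv δ Q) l = (2 * r - 1) * Y l := by
    intro l
    rw [hδQ, divergence_add, divergence_smul, divergence_smul, h.divergence_inverse hg hQ,
      h.two_mul_divergence_ricci hg hQ hd]
    have e2 : ∀ i, d i 2 = 0 := fun i ↦ by
      rw [← map_ofNat (algebraMap ℝ A) 2]; exact (d i).map_algebraMap 2
    simp only [map_neg, Derivation.leibniz, smul_eq_mul, hdr, e2, mul_zero, add_zero,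
      Finset.sum_const_zero, hY, Finset.mul_sum, zero_add, ← Finset.sum_add_distrib,
      ← Finset.sum_neg_distrib]
    exact Finset.sum_congr rfl fun _ _ ↦ by ring
  have hU : ∀ l, ∑ j, Q l j * δ (Γ j).trace = (r * Fintype.card ι - 1) * Y l := by
    intro l
    simp only [hY, Finset.mul_sum]
    refine Finset.sum_congr rfl fun j _ ↦ ?_
    have h2 := h.two_mul_deriv_trace hg hQ hδ j
    have e : d j (-2 * R + 2 * r * R * Fintype.card ι) =
        2 * ((r * Fintype.card ι - 1) * d j R) := by
      have : (-2 * R + 2 * r * R * Fintype.card ι) =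
        (-2 + 2 * ρ * Fintype.card ι : ℝ) • R := by
          rw [Algebra.smul_def]; simp [hr, h2r]; ring
      rw [this, Derivation.map_smul, Algebra.smul_def]; simp [hr, h2r]; ring
    rw [htr, e] at h2
    linear_combination (algebraMap ℝ A (1 / 2) * Q l j) * h2 - Q l j * (δ (Γ j).trace -
      (r * Fintype.card ι - 1) * d j R) * algebraMap_half_mul_two (A := A)
  have hvd : ∀ c : ℝ, vectorDivergence d Γ (fun l ↦ algebraMap ℝ A c * Y l) =
      algebraMap ℝ A c * vectorDivergence d Γ Y := fun c ↦ by
    simp only [vectorDivergence, ← Algebra.smul_def, Derivation.map_smul, Finset.smul_sum,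
      smul_add, mul_smul_comm]
  have hδR : δ R = ∑ i, ∑ k, Q i k * δ (ricciOf d Γ i k) +
      ∑ i, ∑ k, matDeriv δ Q i k * ricciOf d Γ i k := by
    simp only [hR, scalarOf, map_sum, Derivation.leibniz, smul_eq_mul, Finset.sum_add_distrib,
      matDeriv_apply, mul_comm (δ (Q _ _))]
  have hSR : ∑ i, ∑ k, matDeriv δ Q i k * ricciOf d Γ i k =
      2 * ∑ i, ∑ k, S i k * ricciOf d Γ i k - 2 * r * R ^ 2 := by
    have : R = ∑ i, ∑ k, Q i k * ricciOf d Γ i k := rfl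
    rw [pow_two, ← mul_assoc]
    nth_rw 2 [this]
    rw [hδQ]
    simp only [Matrix.add_apply, Matrix.smul_apply, smul_eq_mul, add_mul, Finset.sum_add_distrib,
      Finset.mul_sum]
    simp only [sub_eq_add_neg, ← Finset.sum_neg_distrib, ← mul_assoc, neg_mul]
  -- Here `Y` is the gradient of `R`. The two divergence terms contribute `2ρ - nρ` and `-(nρ - 1)`,
  -- whose sum `1 - 2(n-1)ρ` is the coefficient of the Laplacian.
  have hc1 : ∀ l, (2 * r - 1) * Y l - (r * Fintype.card ι - 1) * Y l =
      algebraMap ℝ A (2 * ρ - ρ * Fintype.card ι) * Y l := fun l ↦ by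
    simp [hr, h2r]; ring
  have hc2 : ∀ l, (r * Fintype.card ι - 1) * Y l =
      algebraMap ℝ A (ρ * Fintype.card ι - 1) * Y l := fun l ↦ by
    simp [hr]
  rw [hδR, hSR, h.sum_inverse_mul_deriv_ricci hg hQ hδ]
  simp only [h.sum_inverse_mul_deriv hg hQ hδ, hdiv, hU, hc1]
  simp only [hc2, hvd]
  rw [← sub_mul, ← map_sub, add_sub_assoc]
  congr 3
  ring

end Evolution

/-! ### The ring of smooth functions on a set -/

section SmoothRing

variable {V : Type*} [NormedAddCommGroup V] [NormedSpace ℝ V]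

/-- The smooth functions on `S`, extended outside of `S` by their value at the base point `x₀`. -/
def SmoothOn (S : Set V) (x₀ : V) : Subalgebra ℝ (V → ℝ) where
  carrier := {f | ContDiffOn ℝ ∞ f S ∧ ∀ x ∉ S, f x = f x₀}
  mul_mem' hf hg := ⟨hf.1.mul hg.1, fun x hx ↦ by simp [hf.2 x hx, hg.2 x hx]⟩
  add_mem' hf hg := ⟨hf.1.add hg.1, fun x hx ↦ by simp [hf.2 x hx, hg.2 x hx]⟩
  algebraMap_mem' _ := ⟨contDiffOn_const, fun _ _ ↦ rfl⟩

variable {S : Set V} {x₀ : V}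

namespace SmoothOn

/-- Evaluation at a point. -/
def ev (x : V) : SmoothOn S x₀ →ₐ[ℝ] ℝ := (Pi.evalAlgHom ℝ (fun _ : V ↦ ℝ) x).comp (Subalgebra.val _)

lemma contDiffOn (f : SmoothOn S x₀) : ContDiffOn ℝ ∞ (fun x ↦ ev x f) S := f.2.1

/-- This is what the normalization outside `S` is for: values off `S` carry no information, so ring
identities and derivation laws need checking only on `S`. -/
lemma ext_on {f h : SmoothOn S x₀} (hx₀ : x₀ ∈ S) (H : ∀ x ∈ S, ev x f = ev x h) : f = h := by
  refine Subtype.ext (funext fun x ↦ ?_)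
  by_cases hx : x ∈ S
  · exact H x hx
  · rw [f.2.2 x hx, h.2.2 x hx]
    exact H x₀ hx₀

open Classical in
/-- The element of the ring given by a function that is smooth on `S`. -/
def mk (hx₀ : x₀ ∈ S) (f : V → ℝ) (hf : ContDiffOn ℝ ∞ f S) : SmoothOn S x₀ :=
  ⟨fun x ↦ if x ∈ S then f x else f x₀, hf.congr fun x hx ↦ by simp [hx],
    fun x hx ↦ by simp [hx, hx₀]⟩

lemma ev_mk (hx₀ : x₀ ∈ S) {f : V → ℝ} (hf : ContDiffOn ℝ ∞ f S) {x : V} (hx : x ∈ S) :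
    ev x (mk hx₀ f hf) = f x := if_pos hx

lemma isUnit_of_ne_zero (hx₀ : x₀ ∈ S) {f : SmoothOn S x₀} (hf : ∀ x ∈ S, ev x f ≠ 0) :
    IsUnit f := by
  refine IsUnit.of_mul_eq_one (mk hx₀ _ ((contDiffOn f).inv hf)) (ext_on hx₀ fun x hx ↦ ?_)
  rw [map_mul, ev_mk hx₀ _ hx, map_one]
  exact mul_inv_cancel₀ (hf x hx)

lemma exists_inverse {ι : Type*} [Fintype ι] [DecidableEq ι] (hx₀ : x₀ ∈ S)
    (G : Matrix ι ι (SmoothOn S x₀)) (hG : ∀ x ∈ S, (G.map (ev x)).det ≠ 0) :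
    ∃ Q : Matrix ι ι (SmoothOn S x₀), Q * G = 1 := by
  refine ⟨G⁻¹, Matrix.nonsing_inv_mul G (isUnit_of_ne_zero hx₀ fun x hx ↦ ?_)⟩
  rw [AlgHom.map_det]
  exact hG x hx

lemma differentiableWithinAt (f : SmoothOn S x₀) {x : V} (hx : x ∈ S) :
    DifferentiableWithinAt ℝ (fun x ↦ ev x f) S x :=
  (contDiffOn f).differentiableOn (by simp) x hx

lemma contDiffOn_fderivWithin (hS : UniqueDiffOn ℝ S) (f : SmoothOn S x₀) :
    ContDiffOn ℝ ∞ (fderivWithin ℝ (fun x ↦ ev x f) S) S :=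
  (contDiffOn f).fderivWithin hS (by simp)

/-- The derivative in the direction `v`. -/
def dir (hS : UniqueDiffOn ℝ S) (hx₀ : x₀ ∈ S) (v : V) :
    Derivation ℝ (SmoothOn S x₀) (SmoothOn S x₀) :=
  .mk' { toFun f := mk hx₀ (fun x ↦ fderivWithin ℝ (fun x ↦ ev x f) S x v)
            ((contDiffOn_fderivWithin hS f).clm_apply contDiffOn_const)
         map_add' f h := ext_on hx₀ fun x hx ↦ by
            rw [map_add, ev_mk _ _ hx, ev_mk _ _ hx, ev_mk _ _ hx]
            simp only [map_add]
            rw [fderivWithin_fun_add (hS x hx) (differentiableWithinAt f hx)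
              (differentiableWithinAt h hx)]
            rfl
         map_smul' c f := ext_on hx₀ fun x hx ↦ by
            rw [RingHom.id_apply, map_smul, ev_mk _ _ hx, ev_mk _ _ hx]
            simp only [map_smul]
            rw [fderivWithin_fun_const_smul (hS x hx) (differentiableWithinAt f hx)]
            rfl }
    fun f h ↦ ext_on hx₀ fun x hx ↦ by
      simp only [LinearMap.coe_mk, AddHom.coe_mk, smul_eq_mul]
      rw [map_add, map_mul, map_mul, ev_mk _ _ hx, ev_mk _ _ hx, ev_mk _ _ hx]
      simp only [map_mul]
      rw [fderivWithin_fun_mul (hS x hx) (differentiableWithinAt f hx)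
        (differentiableWithinAt h hx)]
      simp

lemma ev_dir (hS : UniqueDiffOn ℝ S) (hx₀ : x₀ ∈ S) (v : V) (f : SmoothOn S x₀) {x : V}
    (hx : x ∈ S) : ev x (dir hS hx₀ v f) = fderivWithin ℝ (fun x ↦ ev x f) S x v :=
  ev_mk hx₀ ((contDiffOn_fderivWithin hS f).clm_apply contDiffOn_const) hx

/-- Symmetry of the second derivative within `S`. The hypothesis `hcl` allows boundary points, such
as those with `t = 0`, as limits of interior ones. -/
lemma dir_comm (hS : UniqueDiffOn ℝ S) (hx₀ : x₀ ∈ S) (hcl : S ⊆ closure (interior S)) (v w : V)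
    (f : SmoothOn S x₀) : dir hS hx₀ v (dir hS hx₀ w f) = dir hS hx₀ w (dir hS hx₀ v f) := by
  refine ext_on hx₀ fun x hx ↦ ?_
  have key : ∀ v w, ev x (dir hS hx₀ v (dir hS hx₀ w f)) =
      fderivWithin ℝ (fderivWithin ℝ (fun x ↦ ev x f) S) S x v w := by
    intro v w
    rw [ev_dir _ _ _ _ hx, fderivWithin_congr (fun y hy ↦ ev_dir hS hx₀ w f hy)
      (ev_dir hS hx₀ w f hx), fderivWithin_clm_apply (hS x hx)
      ((contDiffOn_fderivWithin hS f).differentiableOn (by simp) x hx)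
      (differentiableWithinAt_const w)]
    simp
  rw [key, key]
  exact (contDiffOn f x hx).isSymmSndFDerivWithinAt
    (by rw [minSmoothness_of_isRCLikeNormedField]
        exact WithTop.coe_le_coe.mpr (le_top (a := (2 : ℕ∞))))
    hS (hcl hx) hx v w

end SmoothOn

end SmoothRing

/-! ### Comparison with the coordinate formulas -/

section Bridge

open Matrix

variable {n : ℕ} {A : Type*} [CommRing A] [Algebra ℝ A] {d : Fin n → Derivation ℝ A A}
  {ev : EuclideanSpace ℝ (Fin n) → A →ₐ[ℝ] ℝ} {U : Set (EuclideanSpace ℝ (Fin n))}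
  {G : EuclideanSpace ℝ (Fin n) → Matrix (Fin n) (Fin n) ℝ} {g Q : Matrix (Fin n) (Fin n) A}

lemma partialDeriv_congr {f h : EuclideanSpace ℝ (Fin n) → ℝ} {y : EuclideanSpace ℝ (Fin n)}
    (hU : IsOpen U) (hy : y ∈ U) (H : ∀ z ∈ U, f z = h z) (i : Fin n) :
    partialDeriv i f y = partialDeriv i h y := by
  have : f =ᶠ[nhds y] h := Filter.eventuallyEq_of_mem (hU.mem_nhds hy) H
  rw [partialDeriv, this.fderiv_eq, partialDeriv]

section
variable (hU : IsOpen U) (hd : ∀ y ∈ U, ∀ f i, partialDeriv i (fun z ↦ ev z f) y = ev y (d i f))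
  (hG : ∀ y ∈ U, G y = g.map (ev y)) (hQ : Q * g = 1)
include hG hQ

lemma inv_eq_map_ev {y : EuclideanSpace ℝ (Fin n)} (hy : y ∈ U) : (G y)⁻¹ = Q.map (ev y) := by
  refine Matrix.inv_eq_left_inv ?_
  rw [hG y hy, ← Matrix.map_mul, hQ]
  ext i j
  by_cases h : i = j <;> simp [h, one_apply]

include hU hd

lemma christoffel_eq_ev {y : EuclideanSpace ℝ (Fin n)} (hy : y ∈ U) (k i j : Fin n) :
    christoffel G k i j y = ev y (leviCivita d g Q i k j) := by
  have hp : ∀ i j l, partialDeriv i (fun z ↦ G z j l) y = ev y (d i (g j l)) := fun i j l ↦ by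
    rw [← hd y hy]
    exact partialDeriv_congr hU hy (fun z hz ↦ by rw [hG z hz]; rfl) i
  simp only [christoffel, hp, inv_eq_map_ev hG hQ hy, leviCivita, of_apply, map_mul, map_sum,
    map_add, map_sub, AlgHom.commutes, map_apply]
  rfl

/-- The sign convention of `riemannUp` is opposite to that of `curvature`, whence the exchanged
indices `j i`. -/
lemma riemannUp_eq_ev {y : EuclideanSpace ℝ (Fin n)} (hy : y ∈ U) (l i j k : Fin n) :
    riemannUp G l i j k y = ev y (curvature d (leviCivita d g Q) j i l k) := by
  have hc : ∀ {z}, z ∈ U → ∀ k i j, christoffel G k i j z = ev z (leviCivita d g Q i k j) :=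
    fun hz ↦ christoffel_eq_ev hU hd hG hQ hz
  have hp : ∀ m k i j, partialDeriv m (christoffel G k i j) y =
      ev y (d m (leviCivita d g Q i k j)) := fun m k i j ↦ by
    rw [← hd y hy]
    exact partialDeriv_congr hU hy (fun z hz ↦ hc hz k i j) m
  simp only [riemannUp, hp, hc hy, curvature, Matrix.add_apply, Matrix.sub_apply, matDeriv_apply,
    mul_apply, map_add, map_sub, map_sum, map_mul, Finset.sum_sub_distrib]
  simp only [mul_comm]

lemma ricciCoord_eq_ev {y : EuclideanSpace ℝ (Fin n)} (hy : y ∈ U) (i k : Fin n) :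
    ricciCoord G i k y = ev y (ricciOf d (leviCivita d g Q) i k) := by
  have hdet : (G y)⁻¹ * G y = 1 := by
    rw [inv_eq_map_ev hG hQ hy, hG y hy, ← Matrix.map_mul, hQ]
    ext i j
    by_cases h : i = j <;> simp [h, one_apply]
  simp only [ricciCoord, riemannDown, ricciOf, of_apply, map_sum,
    ← riemannUp_eq_ev hU hd hG hQ hy]
  refine Finset.sum_congr rfl fun j _ ↦ ?_
  simp only [Finset.mul_sum, ← mul_assoc]
  rw [Finset.sum_comm]
  simp only [← Finset.sum_mul, ← mul_apply, hdet, one_apply, ite_mul, one_mul, zero_mul,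
    Finset.sum_ite_eq, Finset.mem_univ, if_true]

lemma scalarCoord_eq_ev {y : EuclideanSpace ℝ (Fin n)} (hy : y ∈ U) :
    scalarCoord G y = ev y (scalarOf d Q (leviCivita d g Q)) := by
  simp only [scalarCoord, scalarOf, map_sum, map_mul, ricciCoord_eq_ev hU hd hG hQ hy,
    inv_eq_map_ev hG hQ hy, map_apply]

end

end Bridge

/-! ### Naturality of the curvature under changes of coordinates. -/

section CoordinateChange

open Matrix

variable {n : ℕ}

lemma sum_smul_single (v : EuclideanSpace ℝ (Fin n)) :
    ∑ i, v i • EuclideanSpace.single i (1 : ℝ) = v := by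
  ext j
  simp [Finset.sum_apply, Pi.single_apply]

lemma contDiffOn_coord {V : Type*} [NormedAddCommGroup V] [NormedSpace ℝ V] {S : Set V}
    {f : V → EuclideanSpace ℝ (Fin n)} (hf : ContDiffOn ℝ ∞ f S) (i : Fin n) :
    ContDiffOn ℝ ∞ (fun y ↦ f y i) S :=
  (EuclideanSpace.proj (𝕜 := ℝ) i).contDiff.comp_contDiffOn hf

lemma partialDeriv_ev {U : Set (EuclideanSpace ℝ (Fin n))} {x₀ y : EuclideanSpace ℝ (Fin n)}
    (hU : IsOpen U) (hx₀ : x₀ ∈ U) (hy : y ∈ U) (f : SmoothOn U x₀) (i : Fin n) :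
    partialDeriv i (fun z ↦ SmoothOn.ev z f) y =
      SmoothOn.ev y (SmoothOn.dir hU.uniqueDiffOn hx₀ (EuclideanSpace.single i 1) f) := by
  rw [SmoothOn.ev_dir _ _ _ _ hy, fderivWithin_of_isOpen hU hy, partialDeriv]

/-- Pull-back of smooth functions. -/
def SmoothOn.pullback {V W : Type*} [NormedAddCommGroup V] [NormedSpace ℝ V]
    [NormedAddCommGroup W] [NormedSpace ℝ W] {S : Set V} {S' : Set W} {x₀ : V} {x₀' : W}
    (hx₀ : x₀ ∈ S) (φ : V → W) (hφ : ContDiffOn ℝ ∞ φ S) (hm : Set.MapsTo φ S S') :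
    SmoothOn S' x₀' →ₐ[ℝ] SmoothOn S x₀ where
  toFun f := SmoothOn.mk hx₀ (fun x ↦ SmoothOn.ev (φ x) f)
    ((SmoothOn.contDiffOn f).comp hφ hm)
  map_one' := SmoothOn.ext_on hx₀ fun x hx ↦ by rw [SmoothOn.ev_mk _ _ hx, map_one, map_one]
  map_zero' := SmoothOn.ext_on hx₀ fun x hx ↦ by rw [SmoothOn.ev_mk _ _ hx, map_zero, map_zero]
  map_mul' f h := SmoothOn.ext_on hx₀ fun x hx ↦ by
    rw [map_mul, SmoothOn.ev_mk _ _ hx, SmoothOn.ev_mk _ _ hx, SmoothOn.ev_mk _ _ hx, map_mul]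
  map_add' f h := SmoothOn.ext_on hx₀ fun x hx ↦ by
    rw [map_add, SmoothOn.ev_mk _ _ hx, SmoothOn.ev_mk _ _ hx, SmoothOn.ev_mk _ _ hx, map_add]
  commutes' c := SmoothOn.ext_on hx₀ fun x hx ↦ by
    rw [SmoothOn.ev_mk _ _ hx, AlgHom.commutes, AlgHom.commutes]

lemma SmoothOn.ev_pullback {V W : Type*} [NormedAddCommGroup V] [NormedSpace ℝ V]
    [NormedAddCommGroup W] [NormedSpace ℝ W] {S : Set V} {S' : Set W} {x₀ : V} {x₀' : W}
    (hx₀ : x₀ ∈ S) {φ : V → W} (hφ : ContDiffOn ℝ ∞ φ S) (hm : Set.MapsTo φ S S')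
    (f : SmoothOn S' x₀') {x : V} (hx : x ∈ S) :
    SmoothOn.ev x (SmoothOn.pullback hx₀ φ hφ hm f) = SmoothOn.ev (φ x) f :=
  SmoothOn.ev_mk hx₀ ((SmoothOn.contDiffOn f).comp hφ hm) hx

/-- The Jacobian matrix of `φ`. -/
def jacobian (φ : EuclideanSpace ℝ (Fin n) → EuclideanSpace ℝ (Fin n))
    (y : EuclideanSpace ℝ (Fin n)) : Matrix (Fin n) (Fin n) ℝ :=
  of fun i a ↦ fderiv ℝ φ y (EuclideanSpace.single a 1) i

/-- The Ricci and scalar curvature are natural under changes of coordinates. -/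
theorem curvature_pullback {U U' : Set (EuclideanSpace ℝ (Fin n))} (hU : IsOpen U)
    (hU' : IsOpen U') {φ : EuclideanSpace ℝ (Fin n) → EuclideanSpace ℝ (Fin n)}
    (hφ : ContDiffOn ℝ ∞ φ U) (hm : Set.MapsTo φ U U')
    {G G' : EuclideanSpace ℝ (Fin n) → Matrix (Fin n) (Fin n) ℝ}
    (hG : ∀ i j, ContDiffOn ℝ ∞ (fun y ↦ G y i j) U') (hGs : ∀ y ∈ U', (G y)ᵀ = G y)
    (hGd : ∀ y ∈ U', (G y).det ≠ 0) (hJ : ∀ y ∈ U, (jacobian φ y).det ≠ 0)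
    (hG' : ∀ y ∈ U, G' y = (jacobian φ y)ᵀ * G (φ y) * jacobian φ y)
    {y : EuclideanSpace ℝ (Fin n)} (hy : y ∈ U) :
    (∀ a b, ricciCoord G' a b y = ∑ i, ∑ k, ricciCoord G i k (φ y) *
      jacobian φ y i a * jacobian φ y k b) ∧ scalarCoord G' y = scalarCoord G (φ y) := by
  have hφy := hm hy
  have hcl : U ⊆ closure (interior U) := by rw [hU.interior_eq]; exact subset_closure
  let ψ : SmoothOn U' (φ y) →ₐ[ℝ] SmoothOn U y := SmoothOn.pullback hy φ hφ hm
  let d : Fin n → Derivation ℝ (SmoothOn U' (φ y)) (SmoothOn U' (φ y)) := fun i ↦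
    SmoothOn.dir hU'.uniqueDiffOn hφy (EuclideanSpace.single i 1)
  let d' : Fin n → Derivation ℝ (SmoothOn U y) (SmoothOn U y) := fun i ↦
    SmoothOn.dir hU.uniqueDiffOn hy (EuclideanSpace.single i 1)
  let g : Matrix (Fin n) (Fin n) (SmoothOn U' (φ y)) := of fun i j ↦
    SmoothOn.mk hφy (fun y ↦ G y i j) (hG i j)
  have hg : ∀ z ∈ U', G z = g.map (SmoothOn.ev z) := fun z hz ↦ by
    ext i j; exact (SmoothOn.ev_mk hφy (hG i j) hz).symm
  let φc : Fin n → SmoothOn U y := fun i ↦ SmoothOn.mk hy (fun y ↦ φ y i) (contDiffOn_coord hφ i)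
  let J : Matrix (Fin n) (Fin n) (SmoothOn U y) := of fun i a ↦ d' a (φc i)
  have hJe : ∀ z ∈ U, jacobian φ z = J.map (SmoothOn.ev z) := fun z hz ↦ by
    ext i a
    have hev : ∀ x ∈ U, SmoothOn.ev x (φc i) = φ x i := fun x hx ↦ SmoothOn.ev_mk _ _ hx
    have hdφ : HasFDerivAt φ (fderiv ℝ φ z) z :=
      ((hφ.contDiffAt (hU.mem_nhds hz)).differentiableAt (by simp)).hasFDerivAt
    have : HasFDerivAt (fun x ↦ φ x i)
        ((EuclideanSpace.proj (𝕜 := ℝ) i).comp (fderiv ℝ φ z)) z :=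
      (EuclideanSpace.proj (𝕜 := ℝ) i).hasFDerivAt.comp z hdφ
    change _ = SmoothOn.ev z (d' a (φc i))
    rw [SmoothOn.ev_dir _ _ _ _ hz, fderivWithin_congr hev (hev z hz),
      fderivWithin_of_isOpen hU hz, this.fderiv]
    rfl
  have hdetJ : ∀ z ∈ U, (J.map (SmoothOn.ev z)).det ≠ 0 := fun z hz ↦ by
    rw [← hJe z hz]; exact hJ z hz
  obtain ⟨K, hKJ⟩ := SmoothOn.exists_inverse hy J hdetJ
  obtain ⟨Q, hQ⟩ := SmoothOn.exists_inverse hφy g fun z hz ↦ by rw [← hg z hz]; exact hGd z hz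
  have hJK : J * K = 1 := mul_eq_one_comm.mp hKJ
  have hgs : gᵀ = g := by
    refine Matrix.ext fun i j ↦ ?_
    refine SmoothOn.ext_on hφy fun z hz ↦ ?_
    have := congrFun₂ (hGs z hz) i j
    rwa [hg z hz] at this
  have hψ : ∀ a f, d' a (ψ f) = ∑ i, J i a * ψ (d i f) := by
    intro a f
    refine SmoothOn.ext_on hy fun z hz ↦ ?_
    have hdφ : HasFDerivAt φ (fderiv ℝ φ z) z :=
      ((hφ.contDiffAt (hU.mem_nhds hz)).differentiableAt (by simp)).hasFDerivAt
    have hdf := ((SmoothOn.contDiffOn f).contDiffAt (hU'.mem_nhds (hm hz))).differentiableAt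
      (by simp) |>.hasFDerivAt.comp z hdφ
    have hev : ∀ x ∈ U, SmoothOn.ev x (ψ f) = SmoothOn.ev (φ x) f := fun x hx ↦
      SmoothOn.ev_pullback hy hφ hm f hx
    rw [SmoothOn.ev_dir _ _ _ _ hz, fderivWithin_congr hev (hev z hz),
      fderivWithin_of_isOpen hU hz]
    have h1 := hdf.fderiv
    simp only [Function.comp_def] at h1
    rw [h1, ContinuousLinearMap.comp_apply,
      ← sum_smul_single (fderiv ℝ φ z (EuclideanSpace.single a 1)), map_sum, map_sum]
    refine Finset.sum_congr rfl fun i _ ↦ ?_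
    rw [map_mul, SmoothOn.ev_pullback hy hφ hm _ hz, ← partialDeriv_ev hU' hφy (hm hz), map_smul,
      smul_eq_mul, partialDeriv]
    congr 1
    exact congrFun₂ (hJe z hz) i a
  have hd' : ∀ a b f, d' a (d' b f) = d' b (d' a f) := fun a b f ↦
    SmoothOn.dir_comm _ _ hcl _ _ f
  -- The entries of `J` are derivatives of the components of `φ`, so this is the commutation of `d'
  -- a` and `d' b`.
  have hJs : ∀ a b i, d' a (J i b) = d' b (J i a) := fun a b i ↦ hd' a b (φc i)
  have hLC := isLeviCivita_leviCivita (d := d) hgs (mul_eq_one_comm.mp hQ)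
  have hQψ : Q.map ψ * g.map ψ = 1 := by
    rw [← Matrix.map_mul, hQ, Matrix.map_one ψ (map_zero ψ) (map_one ψ)]
  have hQ' : K * Q.map ψ * Kᵀ * (Jᵀ * g.map ψ * J) = 1 := by
    have : Kᵀ * Jᵀ = 1 := by rw [← transpose_mul, hJK, transpose_one]
    calc K * Q.map ψ * Kᵀ * (Jᵀ * g.map ψ * J) = K * Q.map ψ * (Kᵀ * Jᵀ) * g.map ψ * J := by
          simp only [mul_assoc]
      _ = K * (Q.map ψ * g.map ψ) * J := by rw [this, mul_one]; simp only [mul_assoc]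
      _ = 1 := by rw [hQψ, mul_one, hKJ]
  -- Uniqueness of the Levi-Civita connection replaces the transformation law of Christoffel
  -- symbols.
  have hT := (hLC.transform hgs hψ hJK hJs).eq_leviCivita hQ'
  have hG'e : ∀ z ∈ U, G' z = (Jᵀ * g.map ψ * J).map (SmoothOn.ev z) := fun z hz ↦ by
    rw [hG' z hz, hJe z hz, Matrix.map_mul, Matrix.map_mul, transpose_map, hg _ (hm hz)]
    congr 2
    ext i j
    exact (SmoothOn.ev_pullback hy hφ hm (g i j) hz).symm
  have hb := fun z hz f i ↦ partialDeriv_ev (y := z) hU hy hz f i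
  have hb' := fun z hz f i ↦ partialDeriv_ev (y := z) hU' hφy hz f i
  constructor
  · intro a b
    rw [ricciCoord_eq_ev hU hb hG'e hQ' hy, ← hT, ricciOf_transformedConnection hψ hJK hd' hJs]
    simp only [mul_apply, Finset.sum_mul, map_sum, map_mul, transpose_apply, map_apply]
    rw [Finset.sum_comm]
    refine Finset.sum_congr rfl fun i _ ↦ Finset.sum_congr rfl fun k _ ↦ ?_
    rw [SmoothOn.ev_pullback hy hφ hm _ hy, ricciCoord_eq_ev hU' hb' hg hQ hφy, hJe y hy,
      map_apply, map_apply]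
    ring
  · rw [scalarCoord_eq_ev hU hb hG'e hQ' hy, ← hT, scalarOf_transformedConnection hψ hJK hd' hJs,
      SmoothOn.ev_pullback hy hφ hm _ hy, scalarCoord_eq_ev hU' hb' hg hQ hφy]

end CoordinateChange

/-! ### Trace inequalities for positive semidefinite matrices. -/

section MatrixInequalities

open Matrix

variable {ι : Type*} [Fintype ι]

-- With `X = B* B`, cyclicity turns the trace into that of the positive semidefinite `B Y B*`.
open scoped MatrixOrder Matrix.Norms.L2Operator in
lemma trace_mul_nonneg_of_posSemidef {X Y : Matrix ι ι ℝ} (hX : X.PosSemidef)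
    (hY : Y.PosSemidef) : 0 ≤ (X * Y).trace := by
  classical
  obtain ⟨B, rfl⟩ := CStarAlgebra.nonneg_iff_eq_star_mul_self.mp hX.nonneg
  rw [star_eq_conjTranspose, mul_assoc, trace_mul_comm]
  exact (hY.mul_mul_conjTranspose_same B).trace_nonneg

/-- The Cauchy-Schwarz inequality `(tr_g X)² ≤ n |X|²`. -/
lemma sq_trace_le [DecidableEq ι] [Nonempty ι] {g Q X : Matrix ι ι ℝ} (hg : gᵀ = g)
    (hQ : Q.PosSemidef) (hQg : Q * g = 1) (hX : Xᵀ = X) :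
    (Q * X).trace ^ 2 / Fintype.card ι ≤ (Q * (X * (Q * X))).trace := by
  set c : ℝ := (Q * X).trace / Fintype.card ι with hc
  have hn : (Fintype.card ι : ℝ) ≠ 0 := by positivity
  -- The squared norm of the trace-free part of `X`, which is why `c` is the trace divided by the
  -- dimension.
  have h0 : 0 ≤ (Q * ((X - c • g) * Q * (X - c • g)ᴴ)).trace :=
    trace_mul_nonneg_of_posSemidef hQ (hQ.mul_mul_conjTranspose_same _)
  have h1 : (X - c • g)ᴴ = X - c • g := by
    rw [conjTranspose_eq_transpose_of_trivial, transpose_sub, transpose_smul, hX, hg]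
  have hgQ : g * Q = 1 := mul_eq_one_comm.mp hQg
  have h2 : Q * ((X - c • g) * Q * (X - c • g)) =
      Q * (X * (Q * X)) - (2 * c) • (Q * X) + (c * c) • 1 := by
    simp only [sub_mul, mul_sub, Matrix.smul_mul, Matrix.mul_smul, mul_assoc, hQg, mul_one, smul_smul]
    rw [← mul_assoc g, hgQ, one_mul, two_mul, add_smul]
    abel
  rw [h1, h2, trace_add, trace_sub, trace_smul, trace_smul, trace_one] at h0
  have h3 : c * Fintype.card ι = (Q * X).trace := div_mul_cancel₀ _ hn
  have h4 : (Q * X).trace ^ 2 / Fintype.card ι = c * (Q * X).trace := by rw [hc]; ring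
  simp only [smul_eq_mul] at h0
  rw [mul_assoc c, h3] at h0
  linarith

end MatrixInequalities

/-! ### The second-order condition at a local minimum on the line. -/

section SecondDerivative

/-- If `c < 0`, the second derivative test makes `x` a local maximum as well, so `f` is constant
near `x` and `c = 0`. -/
lemma IsLocalMin.second_deriv_nonneg {f f' : ℝ → ℝ} {x c : ℝ} (hm : IsLocalMin f x)
    (hf : ∀ᶠ s in nhds x, HasDerivAt f (f' s) s) (hf' : HasDerivAt f' c x) : 0 ≤ c := by
  by_contra! hc
  have hd : deriv f =ᶠ[nhds x] f' := hf.mono fun s hs ↦ hs.deriv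
  have hmax : IsLocalMax f x := by
    refine isLocalMax_of_deriv_deriv_neg ?_ hm.deriv_eq_zero hf.self_of_nhds.continuousAt
    rwa [hd.deriv_eq, hf'.deriv]
  have hconst : f =ᶠ[nhds x] fun _ ↦ f x := by
    filter_upwards [hm, hmax] with s h1 h2 using le_antisymm h2 h1
  have h0 : f' =ᶠ[nhds x] fun _ ↦ 0 := by
    filter_upwards [hconst.eventuallyEq_nhds, hd] with s hs hds
    rw [← hds, hs.deriv_eq, deriv_const]
  have := hf'.deriv
  rw [h0.deriv_eq, deriv_const] at this
  exact hc.ne this.symm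

end SecondDerivative

/-! ### From the evolution equation to a differential inequality at a spatial minimum. -/

section PointwiseInequality

open Matrix

variable {n : ℕ} {A : Type*} [CommRing A] [Algebra ℝ A] {d : Fin n → Derivation ℝ A A}
  {δ : Derivation ℝ A A} {g Q : Matrix (Fin n) (Fin n) A} {Γ : Fin n → Matrix (Fin n) (Fin n) A}

/-- The differential inequality for the scalar curvature at a spatial minimum. -/
lemma IsLeviCivita.le_ev_deriv_scalar (hn : 2 ≤ n) (hΓ : IsLeviCivita d g Γ) (hgs : gᵀ = g)
    (hQ : Q * g = 1) (hdc : ∀ i j f, d i (d j f) = d j (d i f))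
    (hδc : ∀ i f, δ (d i f) = d i (δ f)) {ρ : ℝ} (hρ : ρ ≤ 1 / (2 * ((n : ℝ) - 1)))
    (hfl : matDeriv δ g = (-2 : A) • ricciOf d Γ +
      (2 * algebraMap ℝ A ρ * scalarOf d Q Γ) • g)
    (e : A →ₐ[ℝ] ℝ) (hpos : (g.map e).PosDef) (hcrit : ∀ i, e (d i (scalarOf d Q Γ)) = 0)
    (hhess : ∀ v : Fin n → ℝ,
      0 ≤ ∑ i, ∑ j, v i * (v j * e (d j (d i (scalarOf d Q Γ))))) :
    2 * (1 / n - ρ) * e (scalarOf d Q Γ) ^ 2 ≤ e (δ (scalarOf d Q Γ)) := by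
  have hev := hΓ.evolution_scalar hgs hQ hdc hδc ρ hfl
  set R : A := scalarOf d Q Γ with hRdef
  -- The flow equation expresses `Ric` through the symmetric matrices `g` and `δ g`, so the
  -- algebraic symmetries of the curvature are not needed.
  have hRics : (ricciOf d Γ)ᵀ = ricciOf d Γ := by
    have h1 : ricciOf d Γ = algebraMap ℝ A (1 / 2) •
        ((2 * algebraMap ℝ A ρ * R) • g - matDeriv δ g) := by
      rw [hfl, sub_add_cancel_right, neg_smul, neg_neg, smul_smul, algebraMap_half_mul_two,
        one_smul]
    rw [h1, transpose_smul, transpose_sub, transpose_smul, ← matDeriv_transpose, hgs]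
  set q := Q.map e with hq
  set Ric := (ricciOf d Γ).map e with hRicm
  have hqg : q * g.map e = 1 := by
    rw [hq, ← Matrix.map_mul, hQ, Matrix.map_one e (map_zero e) (map_one e)]
  have hqpos : q.PosDef := by
    rw [← Matrix.inv_eq_left_inv hqg]
    exact hpos.inv
  have hqs : qᵀ = q := hqpos.isHermitian
  -- At a critical point the first-order terms of the Laplacian vanish, and the rest is the trace of
  -- the inverse metric times the Hessian.
  have hlap : 0 ≤ e (vectorDivergence d Γ fun l ↦ ∑ k, Q l k * d k R) := by
    let H : Matrix (Fin n) (Fin n) ℝ := of fun i j ↦ e (d j (d i R))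
    have hH : H.PosSemidef := by
      refine .of_dotProduct_mulVec_nonneg ?_ fun v ↦ ?_
      · ext i j
        simp only [H, conjTranspose_apply, of_apply, star_trivial, hdc i j]
      · have := hhess v
        simp only [dotProduct, mulVec, Pi.star_apply, star_trivial, H, of_apply, Finset.mul_sum]
        exact this.trans_eq (Finset.sum_congr rfl fun i _ ↦ Finset.sum_congr rfl fun j _ ↦ by ring)
    have h1 : e (vectorDivergence d Γ fun l ↦ ∑ k, Q l k * d k R) = (q * H).trace := by
      simp only [vectorDivergence, map_sum, map_add, map_mul, Derivation.leibniz, smul_eq_mul,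
        hcrit, mul_zero, zero_mul, add_zero, Finset.sum_const_zero, trace, diag_apply, mul_apply]
      rfl
    rw [h1]
    exact trace_mul_nonneg_of_posSemidef hqpos.posSemidef hH
  have hRtr : e R = (q * Ric).trace := by
    rw [hRdef, scalarOf, trace_mul_comm, trace]
    simp only [diag_apply, mul_apply, map_sum, map_mul]
    refine Finset.sum_congr rfl fun i _ ↦ Finset.sum_congr rfl fun k _ ↦ ?_
    rw [mul_comm, show e (Q i k) = q k i from congrFun₂ hqs k i]
    rfl
  have hnorm : e (∑ i, ∑ k, (Q * (ricciOf d Γ * Q)) i k * ricciOf d Γ i k) =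
      (q * (Ric * (q * Ric))).trace := by
    have h1 : (q * (Ric * (q * Ric))).trace = (q * (Ric * q) * Ricᵀ).trace := by
      rw [hRicm, ← transpose_map, hRics]
      simp only [mul_assoc]
    have h2 : q * (Ric * q) = (Q * (ricciOf d Γ * Q)).map e := by
      rw [Matrix.map_mul, Matrix.map_mul]
    rw [h1, h2]
    simp only [map_sum, map_mul, trace, diag_apply, mul_apply (N := Ricᵀ), transpose_apply]
    rfl
  have : Nonempty (Fin n) := ⟨⟨0, by omega⟩⟩
  have hcs := sq_trace_le (g := g.map e) (Q := q) (X := Ric) (by rw [← transpose_map, hgs])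
    hqpos.posSemidef hqg (by rw [hRicm, ← transpose_map, hRics])
  rw [hev]
  simp only [map_sub, map_add, map_mul, AlgHom.commutes, hnorm, map_pow, map_ofNat]
  rw [← hRtr, Fintype.card_fin] at hcs
  have hn' : (2 : ℝ) ≤ n := by exact_mod_cast hn
  -- The bound on `ρ` is exactly the nonnegativity of the coefficient of the Laplacian.
  have hc : 0 ≤ 1 - 2 * ((n : ℝ) - 1) * ρ := by
    rw [le_div_iff₀ (by linarith)] at hρ
    linarith
  have hprod := mul_nonneg hc hlap
  have h5 : 2 * (1 / (n : ℝ) - ρ) * e R ^ 2 = 2 * (e R ^ 2 / n) - 2 * ρ * e R ^ 2 := by ring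
  rw [h5]
  simp only [Fintype.card_fin, Algebra.algebraMap_self, RingHom.id_apply]
  linarith

end PointwiseInequality

/-! ### Smooth functions on time-space domains and the flow in one chart. -/

section SpaceTime

open Matrix

variable {n : ℕ} {I : Set ℝ} {U : Set (EuclideanSpace ℝ (Fin n))}
  {q₀ : ℝ × EuclideanSpace ℝ (Fin n)}

lemma uniqueDiffOn_prod_open (hI : UniqueDiffOn ℝ I) (hU : IsOpen U) :
    UniqueDiffOn ℝ (I ×ˢ U) := hI.prod hU.uniqueDiffOn

lemma prod_subset_closure_interior (hIc : I ⊆ closure (interior I)) (hU : IsOpen U) :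
    I ×ˢ U ⊆ closure (interior (I ×ˢ U)) := by
  rw [interior_prod_eq, closure_prod_eq, hU.interior_eq]
  exact Set.prod_mono hIc subset_closure

/-- Although differentiability in time is only within `I`, the slice has a full derivative because
`U` is open. -/
lemma hasFDerivAt_slice (hU : IsOpen U) (f : SmoothOn (I ×ˢ U) q₀) {t : ℝ}
    {y : EuclideanSpace ℝ (Fin n)} (ht : t ∈ I) (hy : y ∈ U) :
    HasFDerivAt (fun z ↦ SmoothOn.ev (t, z) f)
      ((fderivWithin ℝ (fun q ↦ SmoothOn.ev q f) (I ×ˢ U) (t, y)).comp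
        (.inr ℝ ℝ (EuclideanSpace ℝ (Fin n)))) y := by
  have h1 := (SmoothOn.differentiableWithinAt f (Set.mk_mem_prod ht hy)).hasFDerivWithinAt
  have h2 : HasFDerivWithinAt (fun z ↦ (t, z)) (.inr ℝ ℝ (EuclideanSpace ℝ (Fin n))) U y :=
    (hasFDerivAt_prodMk_right t y).hasFDerivWithinAt
  exact (h1.comp y h2 fun z hz ↦ Set.mk_mem_prod ht hz).hasFDerivAt (hU.mem_nhds hy)

lemma hasDerivWithinAt_time (hI : UniqueDiffOn ℝ I) (hU : IsOpen U) (hq₀ : q₀ ∈ I ×ˢ U)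
    (f : SmoothOn (I ×ˢ U) q₀) {t : ℝ}
    {y : EuclideanSpace ℝ (Fin n)} (ht : t ∈ I) (hy : y ∈ U) :
    HasDerivWithinAt (fun s ↦ SmoothOn.ev (s, y) f) (SmoothOn.ev (t, y)
      (SmoothOn.dir (uniqueDiffOn_prod_open hI hU) hq₀ (1, 0) f)) I t := by
  have h1 := (SmoothOn.differentiableWithinAt f (Set.mk_mem_prod ht hy)).hasFDerivWithinAt
  have h2 : HasDerivWithinAt (fun s : ℝ ↦ (s, y)) (1, 0) I t :=
    (hasDerivWithinAt_id t I).prodMk (hasDerivWithinAt_const t I y)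
  rw [SmoothOn.ev_dir _ _ _ _ (Set.mk_mem_prod ht hy)]
  exact h1.comp_hasDerivWithinAt t h2 fun s hs ↦ Set.mk_mem_prod hs hy

lemma fderivWithin_inr (hI : UniqueDiffOn ℝ I) (hU : IsOpen U) (hq₀ : q₀ ∈ I ×ˢ U)
    (f : SmoothOn (I ×ˢ U) q₀) {t : ℝ}
    {y : EuclideanSpace ℝ (Fin n)} (ht : t ∈ I) (hy : y ∈ U) (v : EuclideanSpace ℝ (Fin n)) :
    ((fderivWithin ℝ (fun q ↦ SmoothOn.ev q f) (I ×ˢ U) (t, y)).comp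
        (.inr ℝ ℝ (EuclideanSpace ℝ (Fin n)))) v =
      ∑ i, v i * SmoothOn.ev (t, y) (SmoothOn.dir (uniqueDiffOn_prod_open hI hU) hq₀
        (0, EuclideanSpace.single i 1) f) := by
  conv_lhs => rw [← sum_smul_single v]
  rw [map_sum]
  refine Finset.sum_congr rfl fun i _ ↦ ?_
  rw [map_smul, smul_eq_mul, SmoothOn.ev_dir _ _ _ _ (Set.mk_mem_prod ht hy)]
  rfl

lemma partialDeriv_slice (hI : UniqueDiffOn ℝ I) (hU : IsOpen U) (hq₀ : q₀ ∈ I ×ˢ U)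
    (f : SmoothOn (I ×ˢ U) q₀) {t : ℝ}
    {y : EuclideanSpace ℝ (Fin n)} (ht : t ∈ I) (hy : y ∈ U) (i : Fin n) :
    partialDeriv i (fun z ↦ SmoothOn.ev (t, z) f) y =
      SmoothOn.ev (t, y) (SmoothOn.dir (uniqueDiffOn_prod_open hI hU) hq₀
        (0, EuclideanSpace.single i 1) f) := by
  rw [partialDeriv, (hasFDerivAt_slice hU f ht hy).fderiv,
    SmoothOn.ev_dir _ _ _ _ (Set.mk_mem_prod ht hy)]
  rfl

/-- First and second order conditions at a spatial local minimum. -/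
lemma spatial_local_min (hI : UniqueDiffOn ℝ I) (hU : IsOpen U)
    (hq₀ : q₀ ∈ I ×ˢ U) (f : SmoothOn (I ×ˢ U) q₀) {t : ℝ} {y : EuclideanSpace ℝ (Fin n)}
    (ht : t ∈ I) (hy : y ∈ U) (hmin : IsLocalMin (fun z ↦ SmoothOn.ev (t, z) f) y)
    {d : Fin n → Derivation ℝ (SmoothOn (I ×ˢ U) q₀) (SmoothOn (I ×ˢ U) q₀)}
    (hd : d = fun i ↦ SmoothOn.dir (uniqueDiffOn_prod_open hI hU) hq₀
        (0, EuclideanSpace.single i 1)) :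
    (∀ i, SmoothOn.ev (t, y) (d i f) = 0) ∧
      ∀ v : Fin n → ℝ, 0 ≤ ∑ i, ∑ j, v i * (v j * SmoothOn.ev (t, y) (d j (d i f))) := by
  subst hd
  refine ⟨fun i ↦ ?_, fun v ↦ ?_⟩
  · rw [← partialDeriv_slice hI hU hq₀ f ht hy, partialDeriv, hmin.fderiv_eq_zero]
    rfl
  -- The Hessian in direction `v` is the second derivative along the line `y + s w`, which stays in
  -- `U` for small `s`.
  · set w : EuclideanSpace ℝ (Fin n) := WithLp.toLp 2 v
    have hline : ∀ s : ℝ, HasDerivAt (fun s : ℝ ↦ y + s • w) w s := fun s ↦ by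
      simpa using ((hasDerivAt_id s).smul_const w).const_add y
    have hcont : ∀ᶠ s : ℝ in nhds 0, y + s • w ∈ U :=
      (hline 0).continuousAt.eventually_mem (hU.mem_nhds (by simpa using hy))
    have hder : ∀ h : SmoothOn (I ×ˢ U) q₀, ∀ s : ℝ, y + s • w ∈ U →
        HasDerivAt (fun s ↦ SmoothOn.ev (t, y + s • w) h)
          (∑ i, v i * SmoothOn.ev (t, y + s • w) (SmoothOn.dir (uniqueDiffOn_prod_open hI hU) hq₀
            (0, EuclideanSpace.single i 1) h)) s := fun h s hs ↦ by
      have := (hasFDerivAt_slice hU h ht hs).comp_hasDerivAt s (hline s)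
      rwa [fderivWithin_inr hI hU hq₀ h ht hs] at this
    refine IsLocalMin.second_deriv_nonneg (f := fun s : ℝ ↦ SmoothOn.ev (t, y + s • w) f) (x := 0)
      ?_ (hcont.mono fun s hs ↦ hder f s hs) ?_
    · have h0 : y + (0 : ℝ) • w = y := by simp
      have : Filter.Tendsto (fun s : ℝ ↦ y + s • w) (nhds 0) (nhds y) := by
        simpa using (hline 0).continuousAt.tendsto
      have h1 := this.eventually hmin
      simpa only [IsLocalMin, IsMinFilter, h0] using h1
    · have h2 := HasDerivAt.fun_sum fun i (_ : i ∈ Finset.univ) ↦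
        (hder (SmoothOn.dir (uniqueDiffOn_prod_open hI hU) hq₀
            (0, EuclideanSpace.single i 1) f) 0 (by simpa using hy)).const_mul (v i)
      simpa only [zero_smul, add_zero, Finset.mul_sum] using h2

/-- The evolution of the scalar curvature under the Ricci-Bourguignon flow, in coordinates. -/
theorem scalarCoord_evolution (hn : 2 ≤ n) (hI : UniqueDiffOn ℝ I) (hIc : I ⊆ closure (interior I))
    (hU : IsOpen U) {G : ℝ → EuclideanSpace ℝ (Fin n) → Matrix (Fin n) (Fin n) ℝ}
    (hG : ∀ i j, ContDiffOn ℝ ∞ (fun q : ℝ × EuclideanSpace ℝ (Fin n) ↦ G q.1 q.2 i j) (I ×ˢ U))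
    (hpos : ∀ t ∈ I, ∀ y ∈ U, (G t y).PosDef) {ρ : ℝ} (hρ : ρ ≤ 1 / (2 * ((n : ℝ) - 1)))
    (hflow : ∀ t ∈ I, ∀ y ∈ U, ∀ i j, HasDerivWithinAt (fun s ↦ G s y i j)
      (-2 * ricciCoord (G t) i j y + 2 * ρ * scalarCoord (G t) y * G t y i j) I t) :
    ContDiffOn ℝ ∞ (fun q : ℝ × EuclideanSpace ℝ (Fin n) ↦ scalarCoord (G q.1) q.2) (I ×ˢ U) ∧
    ∀ t ∈ I, ∀ y ∈ U, IsLocalMin (scalarCoord (G t)) y →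
      ∃ D, 2 * (1 / n - ρ) * scalarCoord (G t) y ^ 2 ≤ D ∧
        HasDerivWithinAt (fun s ↦ scalarCoord (G s) y) D I t := by
  obtain hemp | ⟨q₀, hq₀⟩ := (I ×ˢ U).eq_empty_or_nonempty
  · rw [hemp]
    exact ⟨contDiffOn_empty, fun t ht y hy ↦
      absurd (Set.mk_mem_prod ht hy) (by rw [hemp]; exact Set.notMem_empty _)⟩
  have hS := uniqueDiffOn_prod_open hI hU
  have hcl := prod_subset_closure_interior hIc hU
  let A := SmoothOn (I ×ˢ U) q₀
  let g : Matrix (Fin n) (Fin n) A := of fun i j ↦ SmoothOn.mk hq₀ _ (hG i j)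
  have hg : ∀ t ∈ I, ∀ y ∈ U, G t y = g.map (SmoothOn.ev (t, y)) := fun t ht y hy ↦ by
    ext i j; exact (SmoothOn.ev_mk hq₀ (hG i j) (Set.mk_mem_prod ht hy)).symm
  have hgs : gᵀ = g := Matrix.ext fun i j ↦ SmoothOn.ext_on hq₀ fun q hq ↦ by
    have := congrFun₂ (hpos q.1 hq.1 q.2 hq.2).isHermitian i j
    rw [hg q.1 hq.1 q.2 hq.2] at this
    exact this
  obtain ⟨Q, hQ⟩ := SmoothOn.exists_inverse hq₀ g fun q hq ↦ by
    rw [← hg q.1 hq.1 q.2 hq.2]; exact (hpos q.1 hq.1 q.2 hq.2).det_pos.ne'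
  let d : Fin n → Derivation ℝ A A := fun i ↦ SmoothOn.dir hS hq₀ (0, EuclideanSpace.single i 1)
  let δ : Derivation ℝ A A := SmoothOn.dir hS hq₀ (1, 0)
  let Γ := leviCivita d g Q
  have hΓ : IsLeviCivita d g Γ := isLeviCivita_leviCivita hgs (mul_eq_one_comm.mp hQ)
  set R : A := scalarOf d Q Γ with hRdef
  have hbr : ∀ t ∈ I, ∀ y ∈ U, ∀ (f : A) i, partialDeriv i (fun z ↦ SmoothOn.ev (t, z) f) y =
      SmoothOn.ev (t, y) (d i f) := fun t ht y hy f i ↦ partialDeriv_slice hI hU hq₀ f ht hy i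
  have hR : ∀ t ∈ I, ∀ y ∈ U, scalarCoord (G t) y = SmoothOn.ev (t, y) R := fun t ht y hy ↦
    scalarCoord_eq_ev (ev := fun z ↦ SmoothOn.ev (t, z)) hU (hbr t ht) (hg t ht) hQ hy
  have hRic : ∀ t ∈ I, ∀ y ∈ U, ∀ i k, ricciCoord (G t) i k y =
      SmoothOn.ev (t, y) (ricciOf d Γ i k) := fun t ht y hy ↦
    ricciCoord_eq_ev (ev := fun z ↦ SmoothOn.ev (t, z)) hU (hbr t ht) (hg t ht) hQ hy
  refine ⟨(SmoothOn.contDiffOn R).congr fun q hq ↦ hR q.1 hq.1 q.2 hq.2,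
    fun t ht y hy hmin ↦ ⟨SmoothOn.ev (t, y) (δ R), ?_,
      (hasDerivWithinAt_time hI hU hq₀ R ht hy).congr (fun s hs ↦ hR s hs y hy) (hR t ht y hy)⟩⟩
  have hfl : matDeriv δ g = (-2 : A) • ricciOf d Γ + (2 * algebraMap ℝ A ρ * R) • g := by
    refine Matrix.ext fun i j ↦ SmoothOn.ext_on hq₀ fun q hq ↦ ?_
    have h1 := hasDerivWithinAt_time hI hU hq₀ (g i j) hq.1 hq.2
    have h2 := (hflow q.1 hq.1 q.2 hq.2 i j).congr (f₁ := fun s ↦ SmoothOn.ev (s, q.2) (g i j))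
      (fun s hs ↦ by rw [hg s hs q.2 hq.2]; rfl) (by rw [hg q.1 hq.1 q.2 hq.2]; rfl)
    -- Uniqueness of derivatives within `I` turns the pointwise flow equation into an identity in
    -- the ring.
    have h3 := (hI q.1 hq.1).eq_deriv _ h1 h2
    rw [hRic q.1 hq.1 q.2 hq.2, hR q.1 hq.1 q.2 hq.2, hg q.1 hq.1 q.2 hq.2, map_apply] at h3
    simp only [matDeriv_apply, Matrix.add_apply, Matrix.smul_apply, smul_eq_mul, map_add, map_mul,
      map_neg, map_ofNat]
    exact h3
  have hdc : ∀ i j f, d i (d j f) = d j (d i f) := fun i j f ↦ SmoothOn.dir_comm hS hq₀ hcl _ _ f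
  have hδc : ∀ i f, δ (d i f) = d i (δ f) := fun i f ↦ SmoothOn.dir_comm hS hq₀ hcl _ _ f
  have hmin' : IsLocalMin (fun z ↦ SmoothOn.ev (t, z) R) y := by
    have : scalarCoord (G t) =ᶠ[nhds y] fun z ↦ SmoothOn.ev (t, z) R :=
      Filter.eventuallyEq_of_mem (hU.mem_nhds hy) fun z hz ↦ hR t ht z hz
    exact hmin.congr this
  obtain ⟨hcrit, hhess⟩ := spatial_local_min hI hU hq₀ R ht hy hmin' (d := d) rfl
  rw [hR t ht y hy]
  refine hΓ.le_ev_deriv_scalar hn hgs hQ hdc hδc hρ hfl _ ?_ hcrit hhess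
  rw [← hg t ht y hy]
  exact hpos t ht y hy

end SpaceTime

/-! ### The scalar maximum principle on a compact space. -/

section MaximumPrinciple

/-- The scalar maximum principle: if the time derivative is nonnegative at spatial minima, then
lower bounds are preserved. -/
theorem maximum_principle {M : Type*} [TopologicalSpace M] [CompactSpace M] {a b : ℝ} (hab : a ≤ b)
    {f : ℝ → M → ℝ}
    (hf : ContinuousOn (fun q : ℝ × M ↦ f q.1 q.2) (Set.Icc a b ×ˢ Set.univ)) {α : ℝ}
    (h0 : ∀ x, α ≤ f a x)
    (hmin : ∀ t ∈ Set.Icc a b, ∀ x, (∀ x', f t x ≤ f t x') →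
      ∃ D, 0 ≤ D ∧ HasDerivWithinAt (fun s ↦ f s x) D (Set.Icc a b) t) (x : M) :
    α ≤ f b x := by
  -- The term `ε (t - a)` makes the time derivative at a spatial minimum strictly positive, so the
  -- minimum over `[a, b] × M` can only occur at `t = a`.
  have key : ∀ ε > 0, α ≤ f b x + ε * (b - a) := by
    intro ε hε
    have hF : ContinuousOn (fun q : ℝ × M ↦ f q.1 q.2 + ε * (q.1 - a))
        (Set.Icc a b ×ˢ Set.univ) := hf.add (by fun_prop)
    obtain ⟨⟨t, z⟩, hq, hm⟩ := (isCompact_Icc.prod isCompact_univ).exists_isMinOn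
      ⟨(a, x), Set.mk_mem_prod (Set.left_mem_Icc.mpr hab) (Set.mem_univ x)⟩ hF
    have ht : t ∈ Set.Icc a b := hq.1
    have hle : ∀ s ∈ Set.Icc a b, ∀ w, f t z + ε * (t - a) ≤ f s w + ε * (s - a) :=
      fun s hs w ↦ hm (Set.mk_mem_prod hs (Set.mem_univ w))
    rcases ht.1.eq_or_lt with rfl | hlt
    · have := hle b (Set.right_mem_Icc.mpr hab) x
      rw [sub_self, mul_zero, add_zero] at this
      exact (h0 z).trans this
    · obtain ⟨D, hD, hder⟩ := hmin t ht z fun w ↦ by simpa using hle t ht w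
      have hder' : HasDerivWithinAt (fun s ↦ f s z + ε * (s - a)) (D + ε) (Set.Icc a b) t := by
        have := hder.fun_add (((hasDerivWithinAt_id t _).sub_const a).const_mul ε)
        rw [mul_one] at this
        exact this
      have hloc : IsLocalMinOn (fun s ↦ f s z + ε * (s - a)) (Set.Icc a b) t :=
        IsMinOn.localize fun s hs ↦ hle s hs z
      -- Only the backward direction is tested, so `t = b` needs no separate treatment.
      have hcone : a - t ∈ posTangentConeAt (Set.Icc a b) t :=
        sub_mem_posTangentConeAt_of_segment_subset
          ((convex_Icc a b).segment_subset ht (Set.left_mem_Icc.mpr hab))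
      have := hloc.hasFDerivWithinAt_nonneg hder'.hasFDerivWithinAt hcone
      simp only [ContinuousLinearMap.toSpanSingleton_apply, smul_eq_mul] at this
      nlinarith
  refine le_of_forall_pos_le_add fun η hη ↦ ?_
  have h1 : 0 < b - a + 1 := by linarith
  -- The added `1` keeps the denominator positive when `a = b`.
  have h2 := key (η / (b - a + 1)) (by positivity)
  have h3 : η / (b - a + 1) * (b - a) ≤ η := by
    rw [div_mul_eq_mul_div, div_le_iff₀ h1]
    nlinarith
  linarith

end MaximumPrinciple

/-! ### Metric and curvature of the manifold in a fixed chart, and change of charts. -/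

section ManifoldCoordinates

variable {n : ℕ} {M : Type*} [TopologicalSpace M]
  [ChartedSpace (EuclideanSpace ℝ (Fin n)) M] [IsManifold (𝓡 n) ∞ M]

omit [IsManifold (𝓡 n) ∞ M] in
lemma mfderivWithin_range_extChartAt_symm (p : M) (y : EuclideanSpace ℝ (Fin n)) :
    mfderivWithin 𝓘(ℝ, EuclideanSpace ℝ (Fin n)) (𝓡 n) (extChartAt (𝓡 n) p).symm
      (Set.range (𝓡 n)) y =
      mfderiv 𝓘(ℝ, EuclideanSpace ℝ (Fin n)) (𝓡 n) (extChartAt (𝓡 n) p).symm y := by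
  rw [ModelWithCorners.range_eq_univ, mfderivWithin_univ]

lemma isManifold_one : IsManifold (𝓡 n) 1 M :=
  IsManifold.of_le (n := ∞) (WithTop.coe_le_coe.mpr (le_top (a := (1 : ℕ∞))))

/-- The coordinate vectors are given by the tangent bundle trivialization. -/
lemma coordVector_eq_symmL (p : M) (i : Fin n) {y : EuclideanSpace ℝ (Fin n)}
    (hy : y ∈ (extChartAt (𝓡 n) p).target) :
    coordVector p i y = (trivializationAt (EuclideanSpace ℝ (Fin n)) (TangentSpace (𝓡 n)) p).symmL ℝ
      ((extChartAt (𝓡 n) p).symm y) (EuclideanSpace.single i 1) := by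
  have : IsManifold (𝓡 n) 1 M := isManifold_one
  rw [TangentBundle.symmL_trivializationAt (by
      rw [← extChartAt_source (𝓡 n)]; exact (extChartAt (𝓡 n) p).map_target hy),
    (extChartAt (𝓡 n) p).right_inv hy, mfderivWithin_range_extChartAt_symm]
  rfl

lemma contMDiffOn_coordVector (p : M) (i : Fin n) :
    ContMDiffOn 𝓘(ℝ, EuclideanSpace ℝ (Fin n)) ((𝓡 n).prod 𝓘(ℝ, EuclideanSpace ℝ (Fin n))) ∞
      (fun y ↦ Bundle.TotalSpace.mk' (EuclideanSpace ℝ (Fin n)) (E := TangentSpace (𝓡 n) (M := M))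
        ((extChartAt (𝓡 n) p).symm y) (coordVector p i y)) (extChartAt (𝓡 n) p).target := by
  have hsymm := contMDiffOn_extChartAt_symm (I := 𝓡 n) (n := ∞) p
  set e := trivializationAt (EuclideanSpace ℝ (Fin n)) (TangentSpace (𝓡 n) (M := M)) p
  have hb : ∀ y ∈ (extChartAt (𝓡 n) p).target, (extChartAt (𝓡 n) p).symm y ∈ e.baseSet :=
    fun y hy ↦ by
      rw [TangentBundle.trivializationAt_baseSet, ← extChartAt_source (𝓡 n)]
      exact (extChartAt (𝓡 n) p).map_target hy
  have h1 := (e.contMDiffOn_symm (IB := 𝓡 n) (n := ∞)).comp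
    (hsymm.prodMk (contMDiffOn_const (c := EuclideanSpace.single i (1 : ℝ))))
    fun y hy ↦ e.mem_target.mpr (hb y hy)
  refine h1.congr fun y hy ↦ ?_
  rw [coordVector_eq_symmL p i hy, e.symmL_apply (hb y hy)]
  exact e.mk_symm (hb y hy) _

/-- The metric components are jointly smooth in time and space. -/
lemma contDiffOn_metricCoord {I : Set ℝ} {g : ℝ → Metric n M}
    (hg : ContMDiffOn (𝓘(ℝ, ℝ).prod (𝓡 n))
    ((𝓡 n).prod 𝓘(ℝ, EuclideanSpace ℝ (Fin n) →L[ℝ] EuclideanSpace ℝ (Fin n) →L[ℝ] ℝ)) ∞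
    (fun q : ℝ × M ↦ Bundle.TotalSpace.mk'
      (EuclideanSpace ℝ (Fin n) →L[ℝ] EuclideanSpace ℝ (Fin n) →L[ℝ] ℝ)
      (E := fun x : M ↦ TangentSpace (𝓡 n) x →L[ℝ] TangentSpace (𝓡 n) x →L[ℝ] ℝ)
      q.2 ((g q.1).inner q.2)) (I ×ˢ Set.univ)) (p : M) (i j : Fin n) :
    ContDiffOn ℝ ∞ (fun q : ℝ × EuclideanSpace ℝ (Fin n) ↦ metricCoord (g q.1) p q.2 i j)
      (I ×ˢ (extChartAt (𝓡 n) p).target) := by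
  set S := I ×ˢ (extChartAt (𝓡 n) p).target
  have hsnd : ContMDiffOn (𝓘(ℝ, ℝ).prod 𝓘(ℝ, EuclideanSpace ℝ (Fin n)))
      𝓘(ℝ, EuclideanSpace ℝ (Fin n)) ∞ (Prod.snd : ℝ × EuclideanSpace ℝ (Fin n) → _) S :=
    contMDiffOn_snd
  have hmaps : Set.MapsTo (Prod.snd : ℝ × EuclideanSpace ℝ (Fin n) → _) S
    (extChartAt (𝓡 n) p).target := fun q hq ↦ hq.2
  have hsymm := (contMDiffOn_extChartAt_symm (I := 𝓡 n) (n := ∞) p).comp hsnd hmaps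
  have hm : ContMDiffOn (𝓘(ℝ, ℝ).prod 𝓘(ℝ, EuclideanSpace ℝ (Fin n))) (𝓘(ℝ, ℝ).prod (𝓡 n)) ∞
      (fun q : ℝ × EuclideanSpace ℝ (Fin n) ↦ (q.1, (extChartAt (𝓡 n) p).symm q.2)) S :=
    contMDiffOn_fst.prodMk hsymm
  have h1 := hg.comp hm fun q hq ↦ Set.mk_mem_prod hq.1 (Set.mem_univ _)
  have hv := fun i ↦ (contMDiffOn_coordVector p i).comp hsnd hmaps
  have h2 := ContMDiffOn.clm_bundle_apply₂ (F₁ := EuclideanSpace ℝ (Fin n))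
    (F₂ := EuclideanSpace ℝ (Fin n)) (F₃ := ℝ) (E₁ := TangentSpace (𝓡 n) (M := M))
    (E₂ := TangentSpace (𝓡 n) (M := M)) (E₃ := Bundle.Trivial M ℝ) h1 (hv i) (hv j)
  have h3 : ContMDiffOn (𝓘(ℝ, ℝ).prod 𝓘(ℝ, EuclideanSpace ℝ (Fin n))) 𝓘(ℝ, ℝ) ∞
      (fun q : ℝ × EuclideanSpace ℝ (Fin n) ↦ metricCoord (g q.1) p q.2 i j) S := by
    intro q hq
    have := h2 q hq
    simp only [Bundle.contMDiffWithinAt_totalSpace] at this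
    exact this.2
  rw [← modelWithCornersSelf_prod, chartedSpaceSelf_prod] at h3
  exact h3.contDiffOn

lemma contDiffOn_metricCoord_const (g : Metric n M) (p : M) (i j : Fin n) :
    ContDiffOn ℝ ∞ (fun y ↦ metricCoord g p y i j) (extChartAt (𝓡 n) p).target := by
  have h0 : ContMDiff (𝓘(ℝ, ℝ).prod (𝓡 n))
    ((𝓡 n).prod 𝓘(ℝ, EuclideanSpace ℝ (Fin n) →L[ℝ] EuclideanSpace ℝ (Fin n) →L[ℝ] ℝ)) ∞
    (fun q : ℝ × M ↦ Bundle.TotalSpace.mk'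
      (EuclideanSpace ℝ (Fin n) →L[ℝ] EuclideanSpace ℝ (Fin n) →L[ℝ] ℝ)
      (E := fun x : M ↦ TangentSpace (𝓡 n) x →L[ℝ] TangentSpace (𝓡 n) x →L[ℝ] ℝ)
      q.2 (g.inner q.2)) := g.contMDiff.comp contMDiff_snd
  have h := contDiffOn_metricCoord (I := Set.univ) (g := fun _ ↦ g) h0.contMDiffOn p i j
  have h1 : ContDiffOn ℝ ∞ (fun y : EuclideanSpace ℝ (Fin n) ↦ ((0 : ℝ), y))
    (extChartAt (𝓡 n) p).target := contDiffOn_const.prodMk contDiffOn_id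
  have hm : Set.MapsTo (fun y : EuclideanSpace ℝ (Fin n) ↦ ((0 : ℝ), y))
      (extChartAt (𝓡 n) p).target (Set.univ ×ˢ (extChartAt (𝓡 n) p).target) :=
    fun y hy ↦ Set.mk_mem_prod (Set.mem_univ _) hy
  generalize hF : (fun q : ℝ × EuclideanSpace ℝ (Fin n) ↦ metricCoord g p q.2 i j) = F at h
  have h2 : (fun y ↦ metricCoord g p y i j) = F ∘ fun y ↦ ((0 : ℝ), y) := by
    rw [← hF, Function.comp_def]
  rw [h2]
  exact ContDiffOn.comp h h1 hm

lemma metricCoord_transpose (g : Metric n M) (p : M) (y : EuclideanSpace ℝ (Fin n)) :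
    (metricCoord g p y).transpose = metricCoord g p y := by
  ext i j
  exact g.symm _ _ _

lemma metricCoord_posDef (g : Metric n M) (p : M) {y : EuclideanSpace ℝ (Fin n)}
    (hy : y ∈ (extChartAt (𝓡 n) p).target) : (metricCoord g p y).PosDef := by
  refine .of_dotProduct_mulVec_pos (metricCoord_transpose g p y) fun v hv ↦ ?_
  set x := (extChartAt (𝓡 n) p).symm y with hx
  set e := trivializationAt (EuclideanSpace ℝ (Fin n)) (TangentSpace (𝓡 n) (M := M)) p
  have hb : x ∈ e.baseSet := by
    rw [TangentBundle.trivializationAt_baseSet, ← extChartAt_source (𝓡 n)]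
    exact (extChartAt (𝓡 n) p).map_target hy
  set w : EuclideanSpace ℝ (Fin n) := WithLp.toLp 2 v with hw
  have hsum : e.symmL ℝ x w = ∑ i, v i • coordVector p i y := by
    conv_lhs => rw [← sum_smul_single w]
    rw [map_sum]
    refine Finset.sum_congr rfl fun i _ ↦ ?_
    rw [map_smul, coordVector_eq_symmL p i hy]
  have hne : e.symmL ℝ x w ≠ 0 := fun h0 ↦ by
    have h1 := e.continuousLinearMapAt_symmL (R := ℝ) hb w
    rw [h0, map_zero] at h1
    exact hv (by simpa [hw] using h1.symm)
  have hpos := g.pos x _ hne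
  rw [hsum] at hpos
  simp only [map_sum, map_smul, _root_.sum_apply, _root_.smul_apply,
    smul_eq_mul, Finset.mul_sum] at hpos
  simp only [dotProduct, Matrix.mulVec, Pi.star_apply, star_trivial, Finset.mul_sum]
  refine hpos.trans_eq ?_
  rw [Finset.sum_comm]
  refine Finset.sum_congr rfl fun i _ ↦ Finset.sum_congr rfl fun j _ ↦ ?_
  rw [metricCoord, Matrix.of_apply]
  ring

section ChartChange

/-- The coordinate change from the chart at `p` to the chart at `q`. -/
def chartChange (p q : M) (y : EuclideanSpace ℝ (Fin n)) : EuclideanSpace ℝ (Fin n) :=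
  extChartAt (𝓡 n) q ((extChartAt (𝓡 n) p).symm y)

/-- The domain of the coordinate change. -/
def chartChangeDomain (p q : M) : Set (EuclideanSpace ℝ (Fin n)) :=
  (extChartAt (𝓡 n) p).target ∩ (extChartAt (𝓡 n) p).symm ⁻¹' (extChartAt (𝓡 n) q).source

variable {p q : M}

omit [IsManifold (𝓡 n) ∞ M] in
lemma isOpen_chartChangeDomain : IsOpen (chartChangeDomain (n := n) p q) :=
  (continuousOn_extChartAt_symm p).isOpen_inter_preimage (isOpen_extChartAt_target p)
    (isOpen_extChartAt_source q)

omit [IsManifold (𝓡 n) ∞ M] in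
lemma mapsTo_chartChange :
    Set.MapsTo (chartChange p q) (chartChangeDomain (n := n) p q) (extChartAt (𝓡 n) q).target :=
  fun _ hy ↦ (extChartAt (𝓡 n) q).map_source hy.2

lemma contDiffOn_chartChange :
    ContDiffOn ℝ ∞ (chartChange p q) (chartChangeDomain (n := n) p q) := by
  rw [← contMDiffOn_iff_contDiffOn]
  refine (contMDiffOn_extChartAt (I := 𝓡 n) (n := ∞) (x := q)).comp
    ((contMDiffOn_extChartAt_symm (I := 𝓡 n) (n := ∞) p).mono Set.inter_subset_left) fun y hy ↦ ?_
  rw [← extChartAt_source (𝓡 n)]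
  exact hy.2

lemma mdifferentiableAt_extChartAt_symm {y : EuclideanSpace ℝ (Fin n)}
    (hy : y ∈ (extChartAt (𝓡 n) p).target) :
    MDifferentiableAt 𝓘(ℝ, EuclideanSpace ℝ (Fin n)) (𝓡 n) (extChartAt (𝓡 n) p).symm y :=
  ((contMDiffOn_extChartAt_symm (I := 𝓡 n) (n := ∞) p).contMDiffAt
    ((isOpen_extChartAt_target p).mem_nhds hy)).mdifferentiableAt (by simp)

lemma hasFDerivAt_chartChange {y : EuclideanSpace ℝ (Fin n)} (hy : y ∈ chartChangeDomain p q) :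
    HasFDerivAt (chartChange p q) (fderiv ℝ (chartChange p q) y) y :=
  ((contDiffOn_chartChange.contDiffAt (isOpen_chartChangeDomain.mem_nhds hy)).differentiableAt
    (by simp)).hasFDerivAt

lemma coordVector_chartChange {y : EuclideanSpace ℝ (Fin n)} (hy : y ∈ chartChangeDomain p q)
    (a : Fin n) :
    (coordVector p a y : EuclideanSpace ℝ (Fin n)) =
      ∑ i, jacobian (chartChange p q) y i a •
        (coordVector q i (chartChange p q y) : EuclideanSpace ℝ (Fin n)) := by
  have h1 := (mdifferentiableAt_extChartAt_symm (mapsTo_chartChange hy)).hasMFDerivAt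
  have h2 := h1.comp y (hasFDerivAt_chartChange hy).hasMFDerivAt
  have h3 : (extChartAt (𝓡 n) p).symm =ᶠ[nhds y]
      (extChartAt (𝓡 n) q).symm ∘ chartChange p q :=
    Filter.eventuallyEq_of_mem (isOpen_chartChangeDomain.mem_nhds hy) fun z hz ↦
      ((extChartAt (𝓡 n) q).left_inv hz.2).symm
  have h4 := (h2.congr_of_eventuallyEq h3).mfderiv
  let L : EuclideanSpace ℝ (Fin n) →L[ℝ] EuclideanSpace ℝ (Fin n) :=
    mfderiv 𝓘(ℝ, EuclideanSpace ℝ (Fin n)) (𝓡 n) (extChartAt (𝓡 n) q).symm (chartChange p q y)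
  have h5 : (coordVector p a y : EuclideanSpace ℝ (Fin n)) =
      L (fderiv ℝ (chartChange p q) y (EuclideanSpace.single a 1)) :=
    congrArg (fun L : EuclideanSpace ℝ (Fin n) →L[ℝ] EuclideanSpace ℝ (Fin n) ↦
      L (EuclideanSpace.single a 1)) h4
  rw [h5, ← sum_smul_single (fderiv ℝ (chartChange p q) y (EuclideanSpace.single a 1)), map_sum]
  refine Finset.sum_congr rfl fun i _ ↦ ?_
  rw [map_smul]
  rfl

/-- All tangent spaces unfold to the model space, so vectors can be moved between propositionally
equal points without a cast. -/
lemma inner_congr (g : Metric n M) {x x' : M} (h : x = x') (v w : EuclideanSpace ℝ (Fin n)) :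
    g.inner x v w = g.inner x' v w := by
  subst h; rfl

lemma metricCoord_chartChange (g : Metric n M) {y : EuclideanSpace ℝ (Fin n)}
    (hy : y ∈ chartChangeDomain p q) :
    metricCoord g p y = (jacobian (chartChange p q) y).transpose *
      metricCoord g q (chartChange p q y) * jacobian (chartChange p q) y := by
  ext a b
  have h0 : (extChartAt (𝓡 n) p).symm y = (extChartAt (𝓡 n) q).symm (chartChange p q y) :=
    ((extChartAt (𝓡 n) q).left_inv hy.2).symm
  have h1 : metricCoord g p y a b =
      g.inner ((extChartAt (𝓡 n) q).symm (chartChange p q y))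
        (∑ i, jacobian (chartChange p q) y i a • coordVector q i (chartChange p q y))
        (∑ i, jacobian (chartChange p q) y i b • coordVector q i (chartChange p q y)) := by
    refine (inner_congr g h0 (coordVector p a y) (coordVector p b y)).trans ?_
    congr 1
    · congr 1
      exact coordVector_chartChange hy a
    · exact coordVector_chartChange hy b
  rw [h1]
  simp only [map_sum, map_smul, _root_.sum_apply, _root_.smul_apply,
    smul_eq_mul, Matrix.mul_apply, Matrix.transpose_apply, Finset.sum_mul, Finset.mul_sum]
  refine Finset.sum_congr rfl fun i _ ↦ Finset.sum_congr rfl fun j _ ↦ ?_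
  rw [metricCoord, Matrix.of_apply]
  ring

/-- The metric determinants in the two charts differ by the square of the Jacobian determinant, and
the one at `p` is positive. -/
lemma jacobian_chartChange_det_ne_zero (g : Metric n M)
    {y : EuclideanSpace ℝ (Fin n)} (hy : y ∈ chartChangeDomain p q) :
    (jacobian (chartChange p q) y).det ≠ 0 := fun h ↦ by
  have h1 := (metricCoord_posDef g p hy.1).det_pos
  rw [metricCoord_chartChange g hy, Matrix.det_mul, h, mul_zero] at h1
  exact h1.false

lemma component_coordVector {y : EuclideanSpace ℝ (Fin n)}
    (hy : y ∈ (extChartAt (𝓡 n) p).target) (a i : Fin n) :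
    component ((extChartAt (𝓡 n) p).symm y) (coordVector p a y) i =
      jacobian (chartChange p ((extChartAt (𝓡 n) p).symm y)) y i a := by
  set q := (extChartAt (𝓡 n) p).symm y with hq
  have : IsManifold (𝓡 n) 1 M := isManifold_one
  have h1 := (mdifferentiableAt_extChartAt_symm hy).hasMFDerivAt
  have h2 : MDifferentiableAt (𝓡 n) 𝓘(ℝ, EuclideanSpace ℝ (Fin n)) (extChartAt (𝓡 n) q)
      ((extChartAt (𝓡 n) p).symm y) := mdifferentiableAt_extChartAt (mem_chart_source _ q)
  let L₁ : EuclideanSpace ℝ (Fin n) →L[ℝ] EuclideanSpace ℝ (Fin n) :=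
    mfderiv 𝓘(ℝ, EuclideanSpace ℝ (Fin n)) (𝓡 n) (extChartAt (𝓡 n) p).symm y
  let L₂ : EuclideanSpace ℝ (Fin n) →L[ℝ] EuclideanSpace ℝ (Fin n) :=
    mfderiv (𝓡 n) 𝓘(ℝ, EuclideanSpace ℝ (Fin n)) (extChartAt (𝓡 n) q) q
  have h3 : HasFDerivAt (chartChange p q) (L₂.comp L₁) y :=
    hasMFDerivAt_iff_hasFDerivAt.mp (h2.hasMFDerivAt.comp y h1)
  rw [jacobian, Matrix.of_apply, h3.fderiv]
  rfl

omit [IsManifold (𝓡 n) ∞ M] in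
lemma mem_chartChangeDomain_self {y : EuclideanSpace ℝ (Fin n)}
    (hy : y ∈ (extChartAt (𝓡 n) p).target) :
    y ∈ chartChangeDomain p ((extChartAt (𝓡 n) p).symm y) :=
  ⟨hy, mem_extChartAt_source _⟩

/-- The left-hand sides use the preferred chart of the point with coordinates `y`, which varies with
`y`; naturality replaces it by the fixed chart at `p`, where derivatives in `y` make sense. -/
lemma curvature_in_chart (g : Metric n M) {y : EuclideanSpace ℝ (Fin n)}
    (hy : y ∈ (extChartAt (𝓡 n) p).target) :
    (∀ a b, ricci g ((extChartAt (𝓡 n) p).symm y) (coordVector p a y) (coordVector p b y) =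
      ricciCoord (metricCoord g p) a b y) ∧
    scalarCurvature g ((extChartAt (𝓡 n) p).symm y) = scalarCoord (metricCoord g p) y := by
  obtain ⟨h1, h2⟩ := curvature_pullback
    (isOpen_chartChangeDomain (p := p) (q := (extChartAt (𝓡 n) p).symm y))
    (isOpen_extChartAt_target _) contDiffOn_chartChange mapsTo_chartChange
    (contDiffOn_metricCoord_const g _) (fun z _ ↦ metricCoord_transpose g _ z)
    (fun z hz ↦ (metricCoord_posDef g _ hz).det_pos.ne')
    (fun z hz ↦ jacobian_chartChange_det_ne_zero g hz) (fun z hz ↦ metricCoord_chartChange g hz)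
    (mem_chartChangeDomain_self hy)
  refine ⟨fun a b ↦ ?_, h2.symm⟩
  rw [h1, ricci]
  simp only [component_coordVector hy]
  rfl

end ChartChange

end ManifoldCoordinates

/-! ### The time interval as a domain of differentiation. -/

section TimeInterval

variable {T : EReal}

lemma ordConnected_timeInterval : (timeInterval T).OrdConnected :=
  ⟨fun _ ha _ hb _ ht ↦ ⟨ha.1.trans ht.1, (EReal.coe_le_coe_iff.mpr ht.2).trans_lt hb.2⟩⟩

lemma interior_timeInterval_nonempty (hT : 0 < T) : (interior (timeInterval T)).Nonempty := by
  obtain ⟨b, hb0, hbT⟩ := EReal.lt_iff_exists_real_btwn.mp hT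
  have hb : (0 : ℝ) < b := by exact_mod_cast hb0
  have hsub : Set.Ioo 0 b ⊆ timeInterval T := fun t ht ↦
    ⟨ht.1.le, (EReal.coe_lt_coe_iff.mpr ht.2).trans hbT⟩
  exact (Set.nonempty_Ioo.mpr hb).mono (interior_maximal hsub isOpen_Ioo)

lemma uniqueDiffOn_timeInterval (hT : 0 < T) : UniqueDiffOn ℝ (timeInterval T) :=
  uniqueDiffOn_convex ordConnected_timeInterval.convex (interior_timeInterval_nonempty hT)

lemma timeInterval_subset_closure_interior (hT : 0 < T) :
    timeInterval T ⊆ closure (interior (timeInterval T)) := by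
  have hconv : Convex ℝ (timeInterval T) := ordConnected_timeInterval.convex
  rw [hconv.closure_interior_eq_closure_of_nonempty_interior (interior_timeInterval_nonempty hT)]
  exact subset_closure

end TimeInterval

/-! ### Consequences for the scalar curvature along the flow. -/

section Flow

variable {n : ℕ} {M : Type*} [TopologicalSpace M]
  [ChartedSpace (EuclideanSpace ℝ (Fin n)) M] [IsManifold (𝓡 n) ∞ M] {ρ : ℝ} {T : EReal}
  {g : ℝ → Metric n M}

lemma IsRBFlow.evolution_in_chart (hn : 2 ≤ n) (hρ : ρ ≤ 1 / (2 * ((n : ℝ) - 1))) (hT : 0 < T)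
    (hg : IsRBFlow ρ T g) (p : M) :
    ContDiffOn ℝ ∞ (fun q : ℝ × EuclideanSpace ℝ (Fin n) ↦ scalarCoord (metricCoord (g q.1) p) q.2)
      (timeInterval T ×ˢ (extChartAt (𝓡 n) p).target) ∧
    ∀ t ∈ timeInterval T, ∀ y ∈ (extChartAt (𝓡 n) p).target,
      IsLocalMin (scalarCoord (metricCoord (g t) p)) y →
      ∃ D, 2 * (1 / n - ρ) * scalarCoord (metricCoord (g t) p) y ^ 2 ≤ D ∧
        HasDerivWithinAt (fun s ↦ scalarCoord (metricCoord (g s) p) y) D (timeInterval T) t := by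
  refine scalarCoord_evolution (G := fun t ↦ metricCoord (g t) p) hn (uniqueDiffOn_timeInterval hT)
    (timeInterval_subset_closure_interior hT) (isOpen_extChartAt_target p)
    (contDiffOn_metricCoord hg.smooth p) (fun t _ y hy ↦ metricCoord_posDef (g t) p hy) hρ
    fun t ht y hy i j ↦ ?_
  have h := hg.equation t ht ((extChartAt (𝓡 n) p).symm y) (coordVector p i y) (coordVector p j y)
  rw [(curvature_in_chart (g t) hy).1 i j, (curvature_in_chart (g t) hy).2] at h
  exact h

lemma IsRBFlow.continuousOn_scalarCurvature (hn : 2 ≤ n) (hρ : ρ ≤ 1 / (2 * ((n : ℝ) - 1)))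
    (hT : 0 < T) (hg : IsRBFlow ρ T g) :
    ContinuousOn (fun q : ℝ × M ↦ scalarCurvature (g q.1) q.2)
      (timeInterval T ×ˢ Set.univ) := by
  refine continuousOn_of_locally_continuousOn fun q _ ↦
    ⟨Set.univ ×ˢ (extChartAt (𝓡 n) q.2).source, isOpen_univ.prod (isOpen_extChartAt_source q.2),
      Set.mk_mem_prod (Set.mem_univ _) (mem_extChartAt_source q.2), ?_⟩
  have h1 := (hg.evolution_in_chart hn hρ hT q.2).1.continuousOn
  have h2 : ContinuousOn (fun r : ℝ × M ↦ (r.1, extChartAt (𝓡 n) q.2 r.2))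
      (timeInterval T ×ˢ (extChartAt (𝓡 n) q.2).source) :=
    continuousOn_fst.prodMk ((continuousOn_extChartAt q.2).comp continuousOn_snd fun r hr ↦ hr.2)
  have h3 := h1.comp h2 fun r hr ↦
    Set.mk_mem_prod hr.1 ((extChartAt (𝓡 n) q.2).map_source hr.2)
  refine (h3.mono fun r hr ↦ ⟨hr.1.1, hr.2.2⟩).congr fun r hr ↦ ?_
  have h4 := (curvature_in_chart (g r.1) ((extChartAt (𝓡 n) q.2).map_source hr.2.2)).2
  rw [(extChartAt (𝓡 n) q.2).left_inv hr.2.2] at h4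
  exact h4

/-- The differential inequality for the scalar curvature at a point where it is minimal. -/
lemma IsRBFlow.exists_deriv_scalarCurvature (hn : 2 ≤ n) (hρ : ρ ≤ 1 / (2 * ((n : ℝ) - 1)))
    (hT : 0 < T) (hg : IsRBFlow ρ T g) {t : ℝ} (ht : t ∈ timeInterval T) {x : M}
    (hx : ∀ x', scalarCurvature (g t) x ≤ scalarCurvature (g t) x') :
    ∃ D, 2 * (1 / n - ρ) * scalarCurvature (g t) x ^ 2 ≤ D ∧
      HasDerivWithinAt (fun s ↦ scalarCurvature (g s) x) D (timeInterval T) t := by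
  have hy := mem_extChartAt_target (I := 𝓡 n) x
  have hmin : IsLocalMin (scalarCoord (metricCoord (g t) x)) (extChartAt (𝓡 n) x x) := by
    filter_upwards [(isOpen_extChartAt_target x).mem_nhds hy] with z hz
    rw [← (curvature_in_chart (g t) hz).2]
    exact hx _
  -- In the chart at `x` itself, `scalarCurvature` at `x` is `scalarCoord` by definition, for all
  -- times at once.
  exact (hg.evolution_in_chart hn hρ hT x).2 t ht _ hy hmin

lemma IsRBFlow.le_scalarCurvature [CompactSpace M] (hn : 2 ≤ n)
    (hρ : ρ ≤ 1 / (2 * ((n : ℝ) - 1))) (hT : 0 < T) (hg : IsRBFlow ρ T g) {a b : ℝ}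
    (ha : a ∈ timeInterval T) (hb : b ∈ timeInterval T) (hab : a ≤ b) {α : ℝ}
    (hα : ∀ x, α ≤ scalarCurvature (g a) x) (x : M) : α ≤ scalarCurvature (g b) x := by
  have hsub : Set.Icc a b ⊆ timeInterval T := ordConnected_timeInterval.out ha hb
  have hn' : (2 : ℝ) ≤ n := by exact_mod_cast hn
  -- Since `n ≥ 2`, one has `n ≤ 2(n-1)`.
  have hc : ρ ≤ 1 / n := hρ.trans (one_div_le_one_div_of_le (by linarith) (by linarith))
  refine maximum_principle (f := fun t ↦ scalarCurvature (g t)) hab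
    ((hg.continuousOn_scalarCurvature hn hρ hT).mono (Set.prod_mono hsub subset_rfl)) hα
    (fun t ht x hx ↦ ?_) x
  obtain ⟨D, hD, hder⟩ := hg.exists_deriv_scalarCurvature hn hρ hT (hsub ht) hx
  have : 0 ≤ 1 / (n : ℝ) - ρ := by linarith
  exact ⟨D, le_trans (by positivity) hD, hder.mono hsub⟩

lemma IsRBFlow.exists_isLeast [CompactSpace M] [Nonempty M] (hn : 2 ≤ n)
    (hρ : ρ ≤ 1 / (2 * ((n : ℝ) - 1))) (hT : 0 < T) (hg : IsRBFlow ρ T g) {t : ℝ}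
    (ht : t ∈ timeInterval T) : ∃ m, IsLeast (Set.range (scalarCurvature (g t))) m := by
  have hc : Continuous (scalarCurvature (g t)) := by
    rw [← continuousOn_univ]
    exact (hg.continuousOn_scalarCurvature hn hρ hT).comp (f := fun x : M ↦ (t, x))
      (by fun_prop) fun x _ ↦ Set.mk_mem_prod ht (Set.mem_univ x)
  exact (isCompact_range hc).exists_isLeast (Set.range_nonempty _)

/-- A positive lower bound for the scalar curvature bounds the existence time. -/
lemma IsRBFlow.time_le [CompactSpace M] [Nonempty M] (hn : 2 ≤ n)
    (hρ : ρ ≤ 1 / (2 * ((n : ℝ) - 1))) (hT : 0 < T) (hg : IsRBFlow ρ T g) {α : ℝ}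
    (hα : 0 < α) (hnρ : (n : ℝ) * ρ < 1) (h0 : ∀ x, α ≤ scalarCurvature (g 0) x) :
    T ≤ (((n : ℝ) / (2 * (1 - (n : ℝ) * ρ) * α) : ℝ) : EReal) := by
  by_contra! hlt
  have hn' : (2 : ℝ) ≤ n := by exact_mod_cast hn
  have hn0 : (0 : ℝ) < n := by linarith
  have hpos : 0 < 1 - (n : ℝ) * ρ := by linarith
  obtain ⟨t, hKt, htT⟩ := EReal.lt_iff_exists_real_btwn.mp hlt
  have hKt' : (n : ℝ) / (2 * (1 - (n : ℝ) * ρ) * α) < t := by exact_mod_cast hKt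
  have ht0 : 0 < t := lt_trans (by positivity) hKt'
  have h0mem : (0 : ℝ) ∈ timeInterval T := ⟨le_rfl, by exact_mod_cast hT⟩
  have htmem : t ∈ timeInterval T := ⟨ht0.le, htT⟩
  have hsub : Set.Icc 0 t ⊆ timeInterval T := ordConnected_timeInterval.out h0mem htmem
  have hRpos : ∀ s ∈ Set.Icc 0 t, ∀ x, 0 < scalarCurvature (g s) x := fun s hs x ↦
    hα.trans_le (hg.le_scalarCurvature hn hρ hT h0mem (hsub hs) hs.1 h0 x)
  set c : ℝ := 2 * (1 / n - ρ) with hc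
  have hcK : c * (n / (2 * (1 - (n : ℝ) * ρ) * α)) = α⁻¹ := by
    rw [hc]; field_simp
  have hcpos : 0 < c := by
    have : c = 2 * (1 - n * ρ) / n := by rw [hc]; field_simp
    rw [this]; positivity
  obtain ⟨x⟩ := ‹Nonempty M›
  -- The comparison equation `u' = c u²` makes `-1/u - c s` constant. As `R > 0`, spatial minima of
  -- this function are those of `R`, where its time derivative is `R'/R² - c ≥ 0`.
  have key := maximum_principle (f := fun s x ↦ -(scalarCurvature (g s) x)⁻¹ - c * s) (α := -α⁻¹)
    ht0.le ?_ (fun z ↦ ?_) (fun s hs z hz ↦ ?_) x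
  · have h1 : 0 < (scalarCurvature (g t) x)⁻¹ :=
      inv_pos.mpr (hRpos t (Set.right_mem_Icc.mpr ht0.le) x)
    have h2 := mul_lt_mul_of_pos_left hKt' hcpos
    rw [hcK] at h2
    linarith
  · have hcont := (hg.continuousOn_scalarCurvature hn hρ hT).mono
      (Set.prod_mono hsub (subset_refl (Set.univ : Set M)))
    exact (hcont.inv₀ fun q hq ↦ (hRpos q.1 hq.1 q.2).ne').neg.sub (by fun_prop)
  · rw [mul_zero, sub_zero, neg_le_neg_iff]
    exact inv_anti₀ hα (h0 z)
  · have hmin : ∀ x', scalarCurvature (g s) z ≤ scalarCurvature (g s) x' := fun x' ↦ by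
      have := hz x'
      rw [sub_le_sub_iff_right, neg_le_neg_iff] at this
      exact (inv_le_inv₀ (hRpos s hs x') (hRpos s hs z)).mp this
    obtain ⟨D, hD, hder⟩ := hg.exists_deriv_scalarCurvature hn hρ hT (hsub hs) hmin
    have hR := hRpos s hs z
    refine ⟨D / scalarCurvature (g s) z ^ 2 - c, ?_, ?_⟩
    · rw [sub_nonneg, le_div_iff₀ (by positivity)]
      exact hD
    · have h1 := ((hder.mono hsub).fun_inv hR.ne').fun_neg.fun_sub
        ((hasDerivWithinAt_id s (Set.Icc 0 t)).const_mul c)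
      have h2 : -(-D / scalarCurvature (g s) z ^ 2) - c * 1 =
          D / scalarCurvature (g s) z ^ 2 - c := by ring
      rw [h2] at h1
      exact h1

end Flow

end RicciBourguignon

end

theorem mainTheorem8 (n : ℕ) (hn : 2 ≤ n) (M : Type*) [TopologicalSpace M] [T2Space M]
    [CompactSpace M] [Nonempty M] [ChartedSpace (EuclideanSpace ℝ (Fin n)) M]
    [IsManifold (𝓡 n) ∞ M] (ρ : ℝ) (hρ : ρ ≤ 1 / (2 * ((n : ℝ) - 1)))
    (T : EReal) (hT : 0 < T) (g : ℝ → Metric n M) (hg : IsRBFlow ρ T g) :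
    (∃ Rmin : ℝ → ℝ,
      (∀ t ∈ timeInterval T, IsLeast (Set.range (scalarCurvature (g t))) (Rmin t)) ∧
      MonotoneOn Rmin (timeInterval T)) ∧
    ∀ α : ℝ, (∀ x : M, α ≤ scalarCurvature (g 0) x) →
      (∀ t ∈ timeInterval T, ∀ x : M, α ≤ scalarCurvature (g t) x) ∧
      (0 < α → (n : ℝ) * ρ < 1 →
        T ≤ (((n : ℝ) / (2 * (1 - (n : ℝ) * ρ) * α) : ℝ) : EReal)) := by
  have h0mem : (0 : ℝ) ∈ timeInterval T := ⟨le_rfl, by exact_mod_cast hT⟩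
  constructor
  · have hex : ∀ t, ∃ m, t ∈ timeInterval T →
        IsLeast (Set.range (scalarCurvature (g t))) m := fun t ↦ by
      by_cases ht : t ∈ timeInterval T
      · obtain ⟨m, hm⟩ := hg.exists_isLeast hn hρ hT ht
        exact ⟨m, fun _ ↦ hm⟩
      -- An arbitrary value outside the time interval makes the choice of `Rmin` total.
      · exact ⟨0, fun h ↦ absurd h ht⟩
    choose Rmin hRmin using hex
    refine ⟨Rmin, hRmin, fun a ha b hb hab ↦ ?_⟩
    -- The minimum at time `b` is attained at `x`, and the minimum at time `a` is a lower bound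
    -- preserved up to time `b`.
    obtain ⟨x, hx⟩ := (hRmin b hb).1
    rw [← hx]
    exact hg.le_scalarCurvature hn hρ hT ha hb hab
      (fun z ↦ (hRmin a ha).2 (Set.mem_range_self z)) x
  · exact fun α hα ↦ ⟨fun t ht x ↦ hg.le_scalarCurvature hn hρ hT h0mem ht ht.1 hα x,
      fun hα0 hnρ ↦ hg.time_le hn hρ hT hα0 hnρ hα⟩
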